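/- Let $n\ge 1$, let $\Omega\subset\mathbb R^n$ be a bounded domain with Lipschitz boundary, let $T>0$ and $Q=\Omega\times(0,T]$. For $1\le p\le\infty$ let $$W^{2,1}_p(Q)=\{f\in L^p(Q): f_t, f_{x_k}, f_{x_kx_\ell}\in L^p(Q),\ 1\le k,\ell\le n\},\qquad W^{1,0}_p(Q)=\{f\in L^p(Q): f_{x_k}\in L^p(Q),\ 1\le k\le n\}$$ (weak derivatives), with the norms $$\|f\|_{W^{2,1}_p(Q)}=\|f\|_{L^p(Q)}+\|f_t\|_{L^p(Q)}+\sum_{k}\|f_{x_k}\|_{L^p(Q)}+\sum_{k,\ell}\|f_{x_kx_\ell}\|_{L^p(Q)},\qquad \|f\|_{W^{1,0}_p(Q)}=\|f\|_{L^p(Q)}+\sum_{k}\|f_{x_k}\|_{L^p(Q)}.$$ Assume that $1\le p\le r\le\infty$ satisfy one of the following conditions: (i) $p<n+2$ and $p\le r<\dfrac{p(n+2)}{n+2-p}$; (ii) $p=n+2\le r<\infty$; (iii) $n+2<p<\infty$ and $r=\infty$. Then $W^{2,1}_p(Q)$ is compactly imbedded in $W^{1,0}_r(Q)$; that is, $W^{2,1}_p(Q)\subset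 W^{1,0}_r(Q)$ and the inclusion map is a continuous, compact linear operator. -/

import Mathlib

open MeasureTheory TopologicalSpace
open scoped ENNReal NNReal ContDiff

namespace ParabolicSobolev

/-- Euclidean space `ℝⁿ`. -/
abbrev E (n : ℕ) : Type := EuclideanSpace ℝ (Fin n)

/-- The boundary of `Ω` is Lipschitz: near each of its points, `Ω` is, in suitable orthogonal
coordinates, the strict epigraph of a Lipschitz function. Here `e` is the vertical unit vector,
`inner ℝ e y` the vertical coordinate of `y` and `y - inner ℝ e y • e` its projection to the
hyperplane orthogonal to `e`. -/
def HasLipschitzBoundary {n : ℕ} (Ω : Set (E n)) : Prop :=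
  ∀ x ∈ frontier Ω, ∃ (e : E n) (γ : E n → ℝ) (K : ℝ≥0) (ρ : ℝ),
    ‖e‖ = 1 ∧ LipschitzWith K γ ∧ 0 < ρ ∧
      ∀ y ∈ Metric.ball x ρ, y ∈ Ω ↔ γ (y - inner ℝ e y • e) < inner ℝ e y

/-- The parabolic cylinder `Q = Ω × (0, T]`. -/
def cylinder {n : ℕ} (Ω : Opens (E n)) (T : ℝ) : Set (E n × ℝ) :=
  (Ω : Set (E n)) ×ˢ Set.Ioc 0 T

/-- Lebesgue measure on `Q`. -/
noncomputable def cylMeasure {n : ℕ} (Ω : Opens (E n)) (T : ℝ) : Measure (E n × ℝ) :=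
  volume.restrict (cylinder Ω T)

/-- The spatial coordinate direction `x_k` in space-time. -/
noncomputable def dirX {n : ℕ} (k : Fin n) : E n × ℝ := (EuclideanSpace.single k 1, 0)

/-- The time direction in space-time. -/
def dirT {n : ℕ} : E n × ℝ := (0, 1)

/-- Classical iterated directional derivative along a list of directions. -/
noncomputable def iterDeriv {n : ℕ} : List (E n × ℝ) → (E n × ℝ → ℝ) → E n × ℝ → ℝ
  | [], φ => φ
  | v :: vs, φ => fun z => fderiv ℝ (iterDeriv vs φ) z v

/-- Test functions: smooth with compact support in the open cylinder `Ω × (0, T)`. -/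
def IsTest {n : ℕ} (Ω : Opens (E n)) (T : ℝ) (φ : E n × ℝ → ℝ) : Prop :=
  ContDiff ℝ ∞ φ ∧ HasCompactSupport φ ∧ tsupport φ ⊆ (Ω : Set (E n)) ×ˢ Set.Ioo 0 T

/-- `g` is the weak derivative of `f` in `Q` along the list of directions `vs`. It is used for
`f`, `g` in `L^p(Q)`, so that the integrands are integrable. -/
def HasWeakDeriv {n : ℕ} (Ω : Opens (E n)) (T : ℝ) (vs : List (E n × ℝ))
    (f g : E n × ℝ → ℝ) : Prop :=
  ∀ φ : E n × ℝ → ℝ, IsTest Ω T φ →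
    ∫ z, f z * iterDeriv vs φ z ∂(cylMeasure Ω T) =
      (-1) ^ vs.length * ∫ z, g z * φ z ∂(cylMeasure Ω T)

section Helpers

variable {n : ℕ} {Ω : Opens (E n)} {T : ℝ} {p : ℝ≥0∞}

instance : IsLocallyFiniteMeasure (cylMeasure Ω T) := by
  unfold cylMeasure; infer_instance

theorem contDiff_iterDeriv (vs : List (E n × ℝ)) {φ : E n × ℝ → ℝ} (h : ContDiff ℝ ∞ φ) :
    ContDiff ℝ ∞ (iterDeriv vs φ) := by
  induction vs with
  | nil => exact h
  | cons v vs ih =>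
    exact (ih.fderiv_right (m := ∞) (by simp)).clm_apply contDiff_const

theorem hasCompactSupport_iterDeriv (vs : List (E n × ℝ)) {φ : E n × ℝ → ℝ}
    (h : HasCompactSupport φ) : HasCompactSupport (iterDeriv vs φ) := by
  induction vs with
  | nil => exact h
  | cons v vs ih => exact ih.fderiv_apply (𝕜 := ℝ) v

theorem integrable_mul [Fact (1 ≤ p)] (f : Lp ℝ p (cylMeasure Ω T)) {ψ : E n × ℝ → ℝ}
    (hψ : ContDiff ℝ ∞ ψ) (hc : HasCompactSupport ψ) :
    Integrable (fun z => f z * ψ z) (cylMeasure Ω T) := by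
  have hf : LocallyIntegrable f (cylMeasure Ω T) := (Lp.memLp f).locallyIntegrable Fact.out
  simpa [mul_comm] using
    hf.integrable_smul_left_of_hasCompactSupport hψ.continuous hc

/-- Uniqueness of the weak derivative. -/
theorem HasWeakDeriv.unique [Fact (1 ≤ p)] {vs : List (E n × ℝ)} {f : E n × ℝ → ℝ}
    {g h : Lp ℝ p (cylMeasure Ω T)} (hg : HasWeakDeriv Ω T vs f g)
    (hh : HasWeakDeriv Ω T vs f h) : g = h := by
  have hU : IsOpen ((Ω : Set (E n)) ×ˢ Set.Ioo 0 T) := Ω.isOpen.prod isOpen_Ioo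
  have key := hU.ae_eq_zero_of_integral_contDiff_smul_eq_zero (μ := cylMeasure Ω T)
    (f := fun z => g z - h z)
    ((((Lp.memLp g).locallyIntegrable Fact.out).sub
      ((Lp.memLp h).locallyIntegrable Fact.out)).locallyIntegrableOn _) (by
      intro φ h1 h2 h3
      have e := (hg φ ⟨h1, h2, h3⟩).symm.trans (hh φ ⟨h1, h2, h3⟩)
      have e' := mul_left_cancel₀ (pow_ne_zero _ (by norm_num)) e
      have : ∀ z, φ z • (g z - h z) = g z * φ z - h z * φ z := fun z => by
        simp only [smul_eq_mul]; ring
      simp only [this]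
      rw [integral_sub (integrable_mul g h1 h2) (integrable_mul h h1 h2), e', sub_self])
  have hT : ∀ᵐ z ∂(volume : Measure (E n × ℝ)), z.2 ≠ T := by
    have : (volume : Measure (E n × ℝ)) (Set.univ ×ˢ {T}) = 0 := by
      rw [Measure.volume_eq_prod, Measure.prod_prod]; simp
    rw [ae_iff]
    convert this using 2
    ext z; simp
  have hQ : ∀ᵐ z ∂(cylMeasure Ω T), z ∈ cylinder Ω T :=
    ae_restrict_mem (Ω.isOpen.measurableSet.prod measurableSet_Ioc)
  have hT' : ∀ᵐ z ∂(cylMeasure Ω T), z.2 ≠ T := ae_restrict_of_ae hT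
  refine Lp.ext ?_
  filter_upwards [key, hQ, hT'] with z h1 h2 h3
  exact sub_eq_zero.1 (h1 ⟨h2.1, h2.2.1, lt_of_le_of_ne h2.2.2 h3⟩)

theorem HasWeakDeriv.add [Fact (1 ≤ p)] {vs : List (E n × ℝ)} {f f' g g' : Lp ℝ p (cylMeasure Ω T)}
    (h : HasWeakDeriv Ω T vs f g) (h' : HasWeakDeriv Ω T vs f' g') :
    HasWeakDeriv Ω T vs (f + f' : Lp ℝ p (cylMeasure Ω T))
      (g + g' : Lp ℝ p (cylMeasure Ω T)) := by
  intro φ hφ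
  have aux : ∀ (a b : Lp ℝ p (cylMeasure Ω T)) (ψ : E n × ℝ → ℝ), ContDiff ℝ ∞ ψ →
      HasCompactSupport ψ →
      ∫ z, (a + b : Lp ℝ p (cylMeasure Ω T)) z * ψ z ∂(cylMeasure Ω T) =
        ∫ z, a z * ψ z ∂(cylMeasure Ω T) + ∫ z, b z * ψ z ∂(cylMeasure Ω T) := by
    intro a b ψ h1 h2
    rw [← integral_add (integrable_mul a h1 h2) (integrable_mul b h1 h2)]
    refine integral_congr_ae ?_
    filter_upwards [Lp.coeFn_add a b] with z hz
    rw [hz, Pi.add_apply, add_mul]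
  rw [aux _ _ _ (contDiff_iterDeriv vs hφ.1) (hasCompactSupport_iterDeriv vs hφ.2.1),
    aux _ _ _ hφ.1 hφ.2.1, h φ hφ, h' φ hφ, mul_add]

theorem HasWeakDeriv.smul {vs : List (E n × ℝ)} {f g : Lp ℝ p (cylMeasure Ω T)} (c : ℝ)
    (h : HasWeakDeriv Ω T vs f g) :
    HasWeakDeriv Ω T vs (c • f : Lp ℝ p (cylMeasure Ω T))
      (c • g : Lp ℝ p (cylMeasure Ω T)) := by
  intro φ hφ
  have aux : ∀ (a : Lp ℝ p (cylMeasure Ω T)) (ψ : E n × ℝ → ℝ),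
      ∫ z, (c • a : Lp ℝ p (cylMeasure Ω T)) z * ψ z ∂(cylMeasure Ω T) =
        c * ∫ z, a z * ψ z ∂(cylMeasure Ω T) := by
    intro a ψ
    rw [← integral_const_mul]
    refine integral_congr_ae ?_
    filter_upwards [Lp.coeFn_smul c a] with z hz
    rw [hz, Pi.smul_apply, smul_eq_mul, mul_assoc]
  rw [aux, aux, h φ hφ]; ring

theorem HasWeakDeriv.zero (vs : List (E n × ℝ)) :
    HasWeakDeriv Ω T vs (0 : Lp ℝ p (cylMeasure Ω T)) (0 : Lp ℝ p (cylMeasure Ω T)) := by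
  intro φ _
  have h0 : ∀ ψ : E n × ℝ → ℝ,
      ∫ z, (0 : Lp ℝ p (cylMeasure Ω T)) z * ψ z ∂(cylMeasure Ω T) = 0 := by
    intro ψ
    refine integral_eq_zero_of_ae ?_
    filter_upwards [Lp.coeFn_zero ℝ p (cylMeasure Ω T)] with z hz
    rw [hz]; simp
  rw [h0, h0, mul_zero]

end Helpers

section Space

variable {n : ℕ} (Ω : Opens (E n)) (T : ℝ) (p : ℝ≥0∞) [Fact (1 ≤ p)]
variable {ι : Type} (D : ι → List (E n × ℝ))

/-- The functions of `L^p(Q)` whose weak derivatives `D i`, `i ∈ ι`, all lie in `L^p(Q)`. -/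
def sobolevSubmodule : Submodule ℝ (Lp ℝ p (cylMeasure Ω T)) where
  carrier := {f | ∀ i, ∃ g : Lp ℝ p (cylMeasure Ω T), HasWeakDeriv Ω T (D i) f g}
  add_mem' := fun ha hb i =>
    ⟨(ha i).choose + (hb i).choose, (ha i).choose_spec.add (hb i).choose_spec⟩
  zero_mem' := fun i => ⟨0, HasWeakDeriv.zero (D i)⟩
  smul_mem' := fun c _ ha i => ⟨c • (ha i).choose, (ha i).choose_spec.smul c⟩

/-- The Sobolev space of the family `D`, as a type of its own: it carries its own norm below, not
the `L^p` norm of the submodule. -/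
def Sobolev : Type := sobolevSubmodule Ω T p D

noncomputable instance : AddCommGroup (Sobolev Ω T p D) :=
  inferInstanceAs (AddCommGroup (sobolevSubmodule Ω T p D))

noncomputable instance : Module ℝ (Sobolev Ω T p D) :=
  inferInstanceAs (Module ℝ (sobolevSubmodule Ω T p D))

variable {Ω T p D}

/-- The element of `L^p(Q)` underlying an element of the Sobolev space. -/
noncomputable def Sobolev.toLp : Sobolev Ω T p D →ₗ[ℝ] Lp ℝ p (cylMeasure Ω T) :=
  (sobolevSubmodule Ω T p D).subtype

/-- The weak derivative `D i f`. -/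
noncomputable def Sobolev.wderiv (i : ι) (f : Sobolev Ω T p D) : Lp ℝ p (cylMeasure Ω T) :=
  (f.2 i).choose

theorem Sobolev.hasWeakDeriv (i : ι) (f : Sobolev Ω T p D) :
    HasWeakDeriv Ω T (D i) f.toLp (f.wderiv i) :=
  (f.2 i).choose_spec

/-- The map `f ↦ (f, (D i f)_i)`, with the `ℓ¹` sum of the `L^p` norms on the target. -/
noncomputable def Sobolev.jet :
    Sobolev Ω T p D →ₗ[ℝ] PiLp 1 (fun _ : Option ι => Lp ℝ p (cylMeasure Ω T)) where
  toFun f := WithLp.toLp 1 fun o => o.elim f.toLp fun i => f.wderiv i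
  map_add' f g := by
    ext1 o
    cases o with
    | none => simp
    | some i =>
      refine ((f + g).hasWeakDeriv i).unique ?_
      simpa using (f.hasWeakDeriv i).add (g.hasWeakDeriv i)
  map_smul' c f := by
    ext1 o
    cases o with
    | none => simp
    | some i =>
      refine ((c • f).hasWeakDeriv i).unique ?_
      simpa using (f.hasWeakDeriv i).smul c

theorem Sobolev.jet_injective :
    Function.Injective (Sobolev.jet : Sobolev Ω T p D →ₗ[ℝ] _) := by
  intro f g h
  exact Subtype.ext (congrArg (fun F => F.ofLp none) h)

variable [Fintype ι]

noncomputable instance : NormedAddCommGroup (Sobolev Ω T p D) :=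
  NormedAddCommGroup.induced _ _ Sobolev.jet Sobolev.jet_injective

noncomputable instance : NormedSpace ℝ (Sobolev Ω T p D) :=
  NormedSpace.induced ℝ (Sobolev Ω T p D) _ Sobolev.jet

/-- The norm is the sum of the `L^p(Q)` norms of `f` and of its weak derivatives `D i f`. -/
theorem Sobolev.norm_eq (f : Sobolev Ω T p D) : ‖f‖ = ‖f.toLp‖ + ∑ i, ‖f.wderiv i‖ := by
  change ‖Sobolev.jet f‖ = _
  rw [PiLp.norm_eq_of_nat 1 (by simp)]
  simp [Sobolev.jet, Fintype.sum_option]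

end Space

/-- The derivatives `u_t`, `u_{x_k}`, `u_{x_k x_l}`. -/
noncomputable def derivs21 (n : ℕ) : Unit ⊕ Fin n ⊕ (Fin n × Fin n) → List (E n × ℝ)
  | Sum.inl _ => [dirT]
  | Sum.inr (Sum.inl k) => [dirX k]
  | Sum.inr (Sum.inr (k, l)) => [dirX l, dirX k]

/-- The derivatives `u_{x_k}`. -/
noncomputable def derivs10 (n : ℕ) : Fin n → List (E n × ℝ) := fun k => [dirX k]

/-- The parabolic Sobolev space `W^{2,1}_p(Q)`, with norm
`‖f‖ + ‖f_t‖ + ∑ k, ‖f_{x_k}‖ + ∑ k l, ‖f_{x_k x_l}‖` (norms in `L^p(Q)`). -/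
abbrev W21 {n : ℕ} (Ω : Opens (E n)) (T : ℝ) (p : ℝ≥0∞) [Fact (1 ≤ p)] : Type :=
  Sobolev Ω T p (derivs21 n)

/-- The parabolic Sobolev space `W^{1,0}_p(Q)`, with norm `‖f‖ + ∑ k, ‖f_{x_k}‖`
(norms in `L^p(Q)`). -/
abbrev W10 {n : ℕ} (Ω : Opens (E n)) (T : ℝ) (p : ℝ≥0∞) [Fact (1 ≤ p)] : Type :=
  Sobolev Ω T p (derivs10 n)

theorem W21.norm_eq {n : ℕ} {Ω : Opens (E n)} {T : ℝ} {p : ℝ≥0∞} [Fact (1 ≤ p)]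
    (f : W21 Ω T p) :
    ‖f‖ = ‖f.toLp‖ + ‖f.wderiv (Sum.inl ())‖ + ∑ k, ‖f.wderiv (Sum.inr (Sum.inl k))‖ +
      ∑ k, ∑ l, ‖f.wderiv (Sum.inr (Sum.inr (k, l)))‖ := by
  rw [Sobolev.norm_eq, Fintype.sum_sum_type, Fintype.sum_sum_type, Fintype.sum_prod_type]
  simp [add_assoc]

end ParabolicSobolev

/-! Let `f` be `u` or some `u_{x_l}`, and compare it with its averages `A_ρ f (z) = ∫ f(w) kern φ z
ρ w dw`, where `φ` is a bump of integral one and the scaling is parabolic: `ρ` in space, `ρ²` in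
time, so the homogeneous dimension is `n + 2`. The support of `φ` need not contain the origin. It is
placed so that the rescaled kernel stays in the open cylinder: inside a cone in space, supplied by
the Lipschitz boundary, and ahead of `z` or behind it in time. No extension operator is needed.

Differentiating in `ρ` replaces `φ` by `divKern φ`, which is the divergence of `φ` times the field
`(y, 2s)` generating the dilations (`divKern_eq`). Integration by parts then gives `|∂_ρ A_ρ f (z)|
≤ C ρ^{-(n+2)} ∫_{box of size ρ} G`, with `G` the sum of the moduli of the derivatives of `u`. For
`f = u_{x_l}` there is no `f_t` to use, but the weak identity `∫ u_{x_l} ζ_t = ∫ u_t ζ_{x_l}`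
replaces it with the same power of `ρ`.

Integration over boxes of volume `V` maps `L^p` to `L^r` with norm `V^{1-1/p+1/r}`. Hence `‖A_a f -
A_{2a} f‖_r ≤ C a^θ ‖G‖_p` with `θ = 1 - (n+2)(1/p - 1/r)`, and each of the three exponent
conditions gives `θ > 0` (`exponent_pos`). Summing over dyadic scales yields `‖f - A_δ f‖_r ≤ C δ^θ
‖G‖_p` on each patch (`exists_eLpNorm_sub_avg_le`).

At a fixed scale `δ` the averages are equicontinuous in `z`, hence determined up to a small error by
finitely many of their values. So `‖f‖_r ≤ ε ‖u‖ + ∑ |l_i(u)|` with finitely many functionals `l_i`.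
This estimate survives finite covers and gives both continuity and compactness of the embedding. -/

namespace ParabolicSobolev

/-! ### Integration over small boxes as a map from `L^p` to `L^r` -/

section LocalIntegral

variable {α : Type*} [MeasurableSpace α] {μ : Measure α} {S : Set (α × α)} {V : ℝ≥0∞}
  {g : α → ℝ≥0∞}

/-- Hölder's inequality against the constant one on the section. -/
theorem setLIntegral_section_le (hV : ∀ z, μ {w | (z, w) ∈ S} ≤ V) {q : ℝ} (hq : 1 ≤ q)
    (hg : Measurable g) (z : α) :
    ∫⁻ w in {w | (z, w) ∈ S}, g w ∂μ ≤
      (∫⁻ w in {w | (z, w) ∈ S}, g w ^ q ∂μ) ^ q⁻¹ * V ^ (1 - q⁻¹) := by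
  have h := eLpNorm'_le_eLpNorm'_mul_rpow_measure_univ (μ := μ.restrict {w | (z, w) ∈ S})
    (f := g) one_pos hq hg.aestronglyMeasurable
  simp only [eLpNorm', enorm_eq_self, ENNReal.rpow_one, one_div, inv_one,
    Measure.restrict_apply_univ] at h
  refine h.trans ?_
  gcongr
  · exact sub_nonneg.2 (inv_le_one_of_one_le₀ hq)
  · exact hV z

theorem measurable_setLIntegral_section [SFinite μ] (hS : MeasurableSet S) (hg : Measurable g) :
    Measurable fun z => ∫⁻ w in {w | (z, w) ∈ S}, g w ∂μ := by
  have h : ∀ z, ∫⁻ w in {w | (z, w) ∈ S}, g w ∂μ =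
      ∫⁻ w, S.indicator (fun x => g x.2) (z, w) ∂μ := fun z => by
    exact (lintegral_indicator (measurable_prodMk_left hS) g).symm
  simp only [h]
  exact ((hg.comp measurable_snd).indicator hS).lintegral_prod_right'

/-- After Tonelli, `g w` is weighted by the measure of all `z` related to `w`; by symmetry these lie
in a section, so the weight is at most `V`. -/
theorem lintegral_setLIntegral_section_le [SFinite μ] (hS : MeasurableSet S)
    (hsymm : ∀ z w, (z, w) ∈ S → (w, z) ∈ S) (hV : ∀ z, μ {w | (z, w) ∈ S} ≤ V)
    (hg : Measurable g) :
    ∫⁻ z, ∫⁻ w in {w | (z, w) ∈ S}, g w ∂μ ∂μ ≤ V * ∫⁻ w, g w ∂μ := by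
  have h : ∀ z, ∫⁻ w in {w | (z, w) ∈ S}, g w ∂μ =
      ∫⁻ w, S.indicator (fun x => g x.2) (z, w) ∂μ := fun z => by
    exact (lintegral_indicator (measurable_prodMk_left hS) g).symm
  simp only [h]
  rw [lintegral_lintegral_swap (f := fun z w => S.indicator (fun x => g x.2) (z, w))
    ((hg.comp measurable_snd).indicator hS).aemeasurable, ← lintegral_const_mul _ hg]
  refine lintegral_mono fun w => ?_
  refine (lintegral_indicator_const (measurable_prodMk_right (y := w) hS) (g w)).trans_le ?_
  rw [mul_comm]
  gcongr
  exact (measure_mono fun z hz => hsymm z w hz).trans (hV w)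

/-- Integration over the sections of a symmetric relation all of whose sections have measure at
most `V` maps `L^p` to `L^r` with norm at most `V ^ (1 - 1 / p + 1 / r)`. -/
theorem eLpNorm_setLIntegral_section_le [SFinite μ] (hS : MeasurableSet S)
    (hsymm : ∀ z w, (z, w) ∈ S → (w, z) ∈ S) (hV0 : V ≠ 0) (hVt : V ≠ ⊤)
    (hV : ∀ z, μ {w | (z, w) ∈ S} ≤ V) {p r : ℝ≥0∞} (hp : 1 ≤ p) (hpt : p ≠ ⊤) (hpr : p ≤ r)
    (hg : Measurable g) :
    eLpNorm (fun z => ∫⁻ w in {w | (z, w) ∈ S}, g w ∂μ) r μ ≤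
      V ^ (1 - p.toReal⁻¹ + r.toReal⁻¹) * eLpNorm g p μ := by
  have hp0 : p ≠ 0 := (zero_lt_one.trans_le hp).ne'
  set q := p.toReal with hq
  have hq1 : 1 ≤ q := by simpa using ENNReal.toReal_mono hpt hp
  have hq0 : 0 < q := zero_lt_one.trans_le hq1
  have hN : eLpNorm g p μ = (∫⁻ w, g w ^ q ∂μ) ^ q⁻¹ := by
    rw [eLpNorm_eq_lintegral_rpow_enorm_toReal hp0 hpt]
    simp [hq]
  set N := eLpNorm g p μ
  set M : α → ℝ≥0∞ := fun z => ∫⁻ w in {w | (z, w) ∈ S}, g w ∂μ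
  have hMm : Measurable M := measurable_setLIntegral_section hS hg
  -- The endpoint `r = ∞`.
  have hsup : ∀ z, M z ≤ N * V ^ (1 - q⁻¹) := fun z => by
    refine (setLIntegral_section_le hV hq1 hg z).trans ?_
    rw [hN]
    gcongr
    exact Measure.restrict_le_self
  -- The endpoint `r = p`: Hölder pointwise, then Tonelli.
  have hInt : ∫⁻ z, M z ^ q ∂μ ≤ (N * V) ^ q := by
    have h1 : ∀ z, M z ^ q ≤ V ^ (q - 1) * ∫⁻ w in {w | (z, w) ∈ S}, g w ^ q ∂μ := fun z => by
      refine (ENNReal.rpow_le_rpow (setLIntegral_section_le hV hq1 hg z) hq0.le).trans_eq ?_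
      rw [ENNReal.mul_rpow_of_nonneg _ _ hq0.le, ← ENNReal.rpow_mul, ← ENNReal.rpow_mul,
        inv_mul_cancel₀ hq0.ne', ENNReal.rpow_one, sub_mul, inv_mul_cancel₀ hq0.ne', one_mul,
        mul_comm]
    refine (lintegral_mono h1).trans ?_
    rw [lintegral_const_mul _ (measurable_setLIntegral_section hS (hg.pow_const q))]
    refine (mul_le_mul_right (lintegral_setLIntegral_section_le hS hsymm hV
      (hg.pow_const q)) _).trans_eq ?_
    rw [ENNReal.mul_rpow_of_nonneg _ _ hq0.le, hN, ← ENNReal.rpow_mul, inv_mul_cancel₀ hq0.ne',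
      ENNReal.rpow_one, ← mul_assoc, mul_comm]
    congr 1
    nth_rewrite 2 [← ENNReal.rpow_one V]
    rw [← ENNReal.rpow_add _ _ hV0 hVt, sub_add_cancel]
  rcases eq_or_ne r ⊤ with rfl | hrt
  · simp only [ENNReal.toReal_top, inv_zero, add_zero, eLpNorm_exponent_top]
    rw [mul_comm]
    exact essSup_le_of_ae_le _ (Filter.Eventually.of_forall hsup)
  have hr0 : r ≠ 0 := (zero_lt_one.trans_le (hp.trans hpr)).ne'
  set s := r.toReal with hs
  have hqs : q ≤ s := ENNReal.toReal_mono hrt hpr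
  have hs0 : 0 < s := hq0.trans_le hqs
  rw [eLpNorm_eq_lintegral_rpow_enorm_toReal hr0 hrt]
  simp only [enorm_eq_self, one_div, ← hs]
  rw [ENNReal.rpow_inv_le_iff hs0]
  -- Interpolation between the endpoints: `M^s = M^(s-q) M^q`, with the first factor bounded by the
  -- supremum.
  calc ∫⁻ z, M z ^ s ∂μ ≤ ∫⁻ z, (N * V ^ (1 - q⁻¹)) ^ (s - q) * M z ^ q ∂μ := by
        refine lintegral_mono fun z => ?_
        have : M z ^ s = M z ^ (s - q) * M z ^ q := by
          rw [← ENNReal.rpow_add_of_nonneg _ _ (sub_nonneg.2 hqs) hq0.le, sub_add_cancel]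
        rw [this]
        exact mul_le_mul_left (ENNReal.rpow_le_rpow (hsup z) (sub_nonneg.2 hqs)) _
    _ ≤ (N * V ^ (1 - q⁻¹)) ^ (s - q) * (N * V) ^ q := by
        rw [lintegral_const_mul _ (hMm.pow_const q)]
        exact mul_le_mul_right hInt _
    _ = (V ^ (1 - q⁻¹ + s⁻¹) * N) ^ s := by
        rw [ENNReal.mul_rpow_of_nonneg _ _ (sub_nonneg.2 hqs), ENNReal.mul_rpow_of_nonneg _ _ hq0.le,
          ENNReal.mul_rpow_of_nonneg _ _ hs0.le, ← ENNReal.rpow_mul, ← ENNReal.rpow_mul,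
          mul_mul_mul_comm, ← ENNReal.rpow_add_of_nonneg _ _ (sub_nonneg.2 hqs) hq0.le,
          ← ENNReal.rpow_add _ _ hV0 hVt, mul_comm]
        congr 2
        · field_simp
          ring
        · ring

end LocalIntegral

/-! ### Compactness from finitely many functionals -/

section CompactnessCriterion

variable {X Y : Type*} [NormedAddCommGroup X] [NormedSpace ℝ X] [NormedAddCommGroup Y]
  [NormedSpace ℝ Y]

/-- A linear operator into a Banach space whose norm is controlled, up to an arbitrarily small
multiple of the norm, by finitely many functionals is compact. -/
theorem isCompactOperator_of_norm_le_add_functionals [CompleteSpace Y] (J : X →L[ℝ] Y)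
    (h : ∀ ε : ℝ, 0 < ε → ∃ L : List (X →L[ℝ] ℝ),
      ∀ u, ‖J u‖ ≤ ε * ‖u‖ + (L.map fun l => |l u|).sum) : IsCompactOperator J := by
  have key : TotallyBounded (J '' Metric.closedBall 0 1) := by
    rw [Metric.totallyBounded_iff]
    intro ε hε
    obtain ⟨L, hL⟩ := h (ε / 4) (by positivity)
    -- The functionals form a finite-dimensional map, so the image of the unit ball under `Λ` has a
    -- finite `η`-net. Two points of the ball whose images are `η`-close have `J`-images at distance
    -- at most `2 · ε/4 + L.length * η < ε`.
    set Λ : X →L[ℝ] (Fin L.length → ℝ) := ContinuousLinearMap.pi fun i => L.get i with hΛ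
    have hsum : ∀ u, (L.map fun l => |l u|).sum ≤ L.length * ‖Λ u‖ := fun u => by
      have : (L.map fun l => |l u|).sum ≤ (L.map fun l => |l u|).length • ‖Λ u‖ := by
        refine List.sum_le_card_nsmul _ _ fun x hx => ?_
        obtain ⟨l, hl, rfl⟩ := List.mem_map.1 hx
        obtain ⟨i, rfl⟩ := List.get_of_mem hl
        exact norm_le_pi_norm (Λ u) i
      simpa using this
    have hb : TotallyBounded (Λ '' Metric.closedBall 0 1) := 
      (((Metric.isBounded_closedBall).image Λ).isCompact_closure.totallyBounded).subset
        subset_closure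
    obtain ⟨η, hη, hηε⟩ : ∃ η : ℝ, 0 < η ∧ L.length * η < ε / 4 := by
      refine ⟨ε / 4 / (L.length + 1), by positivity, ?_⟩
      rw [mul_div_assoc', div_lt_iff₀ (by positivity)]
      nlinarith
    obtain ⟨t, hts, htf, ht⟩ := Metric.finite_approx_of_totallyBounded hb η hη
    choose! v hv hvt using fun y (hy : y ∈ t) => hts hy
    refine ⟨(fun y => J (v y)) '' t, htf.image _, ?_⟩
    rintro _ ⟨u, hu, rfl⟩
    obtain ⟨y, hy, huy⟩ := Set.mem_iUnion₂.1 (ht ⟨u, hu, rfl⟩)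
    refine Set.mem_iUnion₂.2 ⟨_, ⟨y, hy, rfl⟩, ?_⟩
    rw [Metric.mem_ball, dist_eq_norm, ← map_sub]
    have h1 : ‖u - v y‖ ≤ 2 := by
      have := norm_sub_le u (v y)
      have h2 := hv y hy
      rw [mem_closedBall_zero_iff] at hu h2
      linarith
    have h3 : ‖Λ (u - v y)‖ < η := by
      rw [map_sub, hvt y hy, ← dist_eq_norm]
      exact huy
    have h4 : (L.length : ℝ) * ‖Λ (u - v y)‖ ≤ L.length * η := by gcongr
    have := hL (u - v y)
    have := hsum (u - v y)
    nlinarith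
  rw [isCompactOperator_iff_exists_mem_nhds_isCompact_closure_image]
  exact ⟨_, Metric.closedBall_mem_nhds 0 one_pos,
    key.closure.isCompact_of_isClosed isClosed_closure⟩

end CompactnessCriterion

/-! ### Parabolic dilations and rescaled kernels -/

section Kernels

variable {n : ℕ}

/-- Parabolic dilation `(y, s) ↦ (a y, a² s)`. -/
noncomputable def dil (a : ℝ) : E n × ℝ →L[ℝ] E n × ℝ :=
  (a • ContinuousLinearMap.fst ℝ (E n) ℝ).prod (a ^ 2 • ContinuousLinearMap.snd ℝ (E n) ℝ)

theorem dil_apply (a : ℝ) (v : E n × ℝ) : dil a v = (a • v.1, a ^ 2 * v.2) := rfl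

theorem dil_dil_inv {a : ℝ} (ha : a ≠ 0) (v : E n × ℝ) : dil a (dil a⁻¹ v) = v := by
  ext <;> simp [dil_apply, ha]

theorem dil_inv_dil {a : ℝ} (ha : a ≠ 0) (v : E n × ℝ) : dil a⁻¹ (dil a v) = v := by
  ext <;> simp [dil_apply, ha]

theorem dil_dirX (a : ℝ) (k : Fin n) : dil a (dirX k) = a • dirX k := by
  simp [dil_apply, dirX]

theorem dil_dirT (a : ℝ) : dil a (dirT : E n × ℝ) = a ^ 2 • dirT := by
  simp [dil_apply, dirT]

/-- The kernel `ψ` rescaled parabolically to scale `ρ` and centred at `z`. -/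
noncomputable def kern (ψ : E n × ℝ → ℝ) (z : E n × ℝ) (ρ : ℝ) (w : E n × ℝ) : ℝ :=
  ρ⁻¹ ^ (n + 2) * ψ (dil ρ⁻¹ (w - z))

/-- Pairs of points within parabolic distance `R ρ`. -/
def boxRel (n : ℕ) (R ρ : ℝ) : Set ((E n × ℝ) × (E n × ℝ)) :=
  {x | ‖x.2.1 - x.1.1‖ ≤ R * ρ ∧ |x.2.2 - x.1.2| ≤ R * ρ ^ 2}

theorem isClosed_boxRel (R ρ : ℝ) : IsClosed (boxRel n R ρ) :=
  (isClosed_le (f := fun x : (E n × ℝ) × (E n × ℝ) => ‖x.2.1 - x.1.1‖) (by fun_prop)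
    continuous_const).inter
    (isClosed_le (f := fun x : (E n × ℝ) × (E n × ℝ) => |x.2.2 - x.1.2|) (by fun_prop)
      continuous_const)

theorem boxRel_symm (R ρ : ℝ) (z w : E n × ℝ) (h : (z, w) ∈ boxRel n R ρ) :
    (w, z) ∈ boxRel n R ρ := by
  simpa [boxRel, norm_sub_rev, abs_sub_comm] using h

theorem boxRel_mono {R ρ ρ' : ℝ} (hR : 0 ≤ R) (hρ : 0 ≤ ρ) (h : ρ ≤ ρ') :
    boxRel n R ρ ⊆ boxRel n R ρ' := fun _ hx =>
  ⟨hx.1.trans (by gcongr), hx.2.trans (by gcongr)⟩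

/-- The `n` space directions contribute `ρ ^ n` and time contributes `ρ ^ 2`: this is where the
homogeneous dimension `n + 2` enters. -/
theorem volume_boxRel_le {R : ℝ} (hR : 0 < R) : ∃ c : ℝ, 0 < c ∧ ∀ ρ : ℝ, 0 < ρ → ∀ z,
    volume {w | (z, w) ∈ boxRel n R ρ} ≤ ENNReal.ofReal (c * ρ ^ (n + 2)) := by
  refine ⟨R ^ n * (volume (Metric.ball (0 : E n) 1)).toReal * (2 * R), ?_, fun ρ hρ z => ?_⟩
  · have : 0 < (volume (Metric.ball (0 : E n) 1)).toReal :=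
      ENNReal.toReal_pos (Metric.measure_ball_pos _ _ one_pos).ne' measure_ball_lt_top.ne
    positivity
  · have h : {w | (z, w) ∈ boxRel n R ρ} =
        Metric.closedBall z.1 (R * ρ) ×ˢ Metric.closedBall z.2 (R * ρ ^ 2) := by
      ext w
      simp [boxRel, dist_eq_norm]
    rw [h, Measure.volume_eq_prod, Measure.prod_prod, Real.volume_closedBall,
      Measure.addHaar_closedBall _ _ (by positivity), finrank_euclideanSpace_fin,
      ← ENNReal.ofReal_toReal (measure_ball_lt_top (μ := (volume : Measure (E n)))).ne,
      ← ENNReal.ofReal_mul (by positivity), ← ENNReal.ofReal_mul (by positivity)]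
    refine (congrArg ENNReal.ofReal ?_).le
    rw [ENNReal.toReal_ofReal ENNReal.toReal_nonneg]
    ring

/-- Smooth functions with compact support in `U`. -/
def IsTestIn (U : Set (E n × ℝ)) (ψ : E n × ℝ → ℝ) : Prop :=
  ContDiff ℝ ∞ ψ ∧ HasCompactSupport ψ ∧ tsupport ψ ⊆ U

namespace IsTestIn

variable {U : Set (E n × ℝ)} {ψ : E n × ℝ → ℝ}

theorem fderiv_apply (h : IsTestIn U ψ) (v : E n × ℝ) :
    IsTestIn U fun y => fderiv ℝ ψ y v :=
  ⟨contDiff_iterDeriv [v] h.1, hasCompactSupport_iterDeriv [v] h.2.1,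
    (tsupport_fderiv_apply_subset ℝ v).trans h.2.2⟩

theorem mul_left (h : IsTestIn U ψ) {a : E n × ℝ → ℝ} (ha : ContDiff ℝ ∞ a) :
    IsTestIn U fun y => a y * ψ y :=
  ⟨ha.mul h.1, h.2.1.mul_left, (tsupport_mul_subset_right).trans h.2.2⟩

theorem exists_bound (h : IsTestIn U ψ) : ∃ B : ℝ, 0 ≤ B ∧ ∀ y, |ψ y| ≤ B := by
  obtain ⟨B, hB⟩ := h.1.continuous.bounded_above_of_compact_support h.2.1
  exact ⟨B, (norm_nonneg _).trans (hB 0), hB⟩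

end IsTestIn

variable {ψ : E n × ℝ → ℝ}

theorem contDiff_kern (hψ : ContDiff ℝ ∞ ψ) (z : E n × ℝ) (ρ : ℝ) :
    ContDiff ℝ ∞ (kern ψ z ρ) := by
  unfold kern
  fun_prop

theorem fderiv_kern (hψ : ContDiff ℝ ∞ ψ) (z : E n × ℝ) (ρ : ℝ) (w v : E n × ℝ) :
    fderiv ℝ (kern ψ z ρ) w v = kern (fun y => fderiv ℝ ψ y (dil ρ⁻¹ v)) z ρ w := by
  have h1 : HasFDerivAt (fun w => dil ρ⁻¹ (w - z)) (dil ρ⁻¹ : E n × ℝ →L[ℝ] E n × ℝ) w :=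
    (dil ρ⁻¹).hasFDerivAt.comp w ((hasFDerivAt_id w).sub_const z)
  have h2 := (((hψ.differentiable (by simp)) (dil ρ⁻¹ (w - z))).hasFDerivAt.comp w h1).const_mul
    (ρ⁻¹ ^ (n + 2))
  have h3 : fderiv ℝ (kern ψ z ρ) w = _ := h2.fderiv
  rw [h3]
  rfl

theorem fderiv_kern_dirX (hψ : ContDiff ℝ ∞ ψ) (z : E n × ℝ) (ρ : ℝ) (w : E n × ℝ) (k : Fin n) :
    fderiv ℝ (kern ψ z ρ) w (dirX k) = ρ⁻¹ * kern (fun y => fderiv ℝ ψ y (dirX k)) z ρ w := by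
  rw [fderiv_kern hψ, dil_dirX]
  simp only [kern, map_smul, smul_eq_mul]
  ring

theorem fderiv_kern_dirT (hψ : ContDiff ℝ ∞ ψ) (z : E n × ℝ) (ρ : ℝ) (w : E n × ℝ) :
    fderiv ℝ (kern ψ z ρ) w dirT = ρ⁻¹ ^ 2 * kern (fun y => fderiv ℝ ψ y dirT) z ρ w := by
  rw [fderiv_kern hψ, dil_dirT]
  simp only [kern, map_smul, smul_eq_mul]
  ring

theorem tsupport_kern_subset (z : E n × ℝ) {ρ : ℝ} (hρ : ρ ≠ 0) :
    tsupport (kern ψ z ρ) ⊆ (fun y => z + dil ρ y) '' tsupport ψ := by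
  have h : (fun y => z + dil ρ y) '' tsupport ψ = (fun w => dil ρ⁻¹ (w - z)) ⁻¹' tsupport ψ := by
    ext w
    constructor
    · rintro ⟨y, hy, rfl⟩
      simpa [dil_inv_dil hρ] using hy
    · intro hw
      exact ⟨_, hw, by simp [dil_dil_inv hρ]⟩
  rw [h]
  refine closure_minimal (fun w hw => subset_tsupport ψ ?_)
    ((isClosed_tsupport ψ).preimage (by fun_prop))
  exact right_ne_zero_of_mul hw

theorem IsTestIn.isTest_kern {U : Set (E n × ℝ)} (hψ : IsTestIn U ψ) {Ω : Opens (E n)} {T : ℝ}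
    {z : E n × ℝ} {ρ : ℝ} (hρ : ρ ≠ 0)
    (hz : ∀ y ∈ U, z + dil ρ y ∈ (Ω : Set (E n)) ×ˢ Set.Ioo 0 T) : IsTest Ω T (kern ψ z ρ) := by
  refine ⟨contDiff_kern hψ.1 z ρ, ?_, (tsupport_kern_subset z hρ).trans ?_⟩
  · exact (hψ.2.1.isCompact.image (by fun_prop)).of_isClosed_subset (isClosed_tsupport _)
      (tsupport_kern_subset z hρ)
  · rintro _ ⟨y, hy, rfl⟩
    exact hz y (hψ.2.2 hy)

theorem enorm_kern_le {R B : ℝ} (hR : tsupport ψ ⊆ Metric.closedBall 0 R)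
    (hB : ∀ y, |ψ y| ≤ B) (z : E n × ℝ) {ρ : ℝ} (hρ : 0 < ρ) (w : E n × ℝ) :
    ‖kern ψ z ρ w‖ₑ ≤ {w | (z, w) ∈ boxRel n R ρ}.indicator
      (fun _ => ENNReal.ofReal (B * ρ⁻¹ ^ (n + 2))) w := by
  by_cases hw : dil ρ⁻¹ (w - z) ∈ tsupport ψ
  · have hw' : w ∈ {w | (z, w) ∈ boxRel n R ρ} := by
      have h := mem_closedBall_zero_iff.1 (hR hw)
      rw [dil_apply, Prod.norm_def, max_le_iff] at h
      simp only [norm_smul, norm_mul, norm_inv, norm_pow, Real.norm_eq_abs, abs_of_pos hρ,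
        Prod.fst_sub, Prod.snd_sub] at h
      constructor
      · have := h.1
        rwa [inv_mul_le_iff₀ hρ, mul_comm] at this
      · have := h.2
        rwa [inv_pow, inv_mul_le_iff₀ (by positivity), mul_comm] at this
    rw [Set.indicator_of_mem hw', Real.enorm_eq_ofReal_abs, kern, abs_mul,
      abs_of_nonneg (by positivity), mul_comm]
    gcongr
    exact hB _
  · rw [kern, image_eq_zero_of_notMem_tsupport hw]
    simp

theorem enorm_integral_mul_kern_le {R B : ℝ} (hR : tsupport ψ ⊆ Metric.closedBall 0 R)
    (hB : ∀ y, |ψ y| ≤ B) (z : E n × ℝ) {ρ : ℝ} (hρ : 0 < ρ) (f : E n × ℝ → ℝ)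
    (μ : Measure (E n × ℝ)) :
    ‖∫ w, f w * kern ψ z ρ w ∂μ‖ₑ ≤
      ENNReal.ofReal (B * ρ⁻¹ ^ (n + 2)) * ∫⁻ w in {w | (z, w) ∈ boxRel n R ρ}, ‖f w‖ₑ ∂μ := by
  refine (enorm_integral_le_lintegral_enorm _).trans ?_
  have hm : MeasurableSet {w | (z, w) ∈ boxRel n R ρ} :=
    ((isClosed_boxRel R ρ).preimage (by fun_prop : Continuous fun w => (z, w))).measurableSet
  rw [← lintegral_const_mul' _ _ ENNReal.ofReal_ne_top, ← lintegral_indicator hm]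
  refine lintegral_mono fun w => ?_
  rw [enorm_mul]
  refine (mul_le_mul_right (enorm_kern_le hR hB z hρ w) _).trans_eq ?_
  by_cases hw : w ∈ {w | (z, w) ∈ boxRel n R ρ}
  · rw [Set.indicator_of_mem hw, Set.indicator_of_mem hw, mul_comm]
  · rw [Set.indicator_of_notMem hw, Set.indicator_of_notMem hw, mul_zero]

/-- The kernel which appears in the derivative of `kern φ z ρ` in `ρ`. -/
noncomputable def divKern (φ : E n × ℝ → ℝ) (y : E n × ℝ) : ℝ :=
  (n + 2) * φ y + fderiv ℝ φ y (y.1, 2 * y.2)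

/-- In the variable `a = ρ⁻¹`, the curve `dil a v` has velocity `a⁻¹ (y, 2s)` at the point `(y, s) =
dil a v`, so `a ^ (n + 2) * φ (dil a v)` has derivative `a ^ (n + 1) * divKern φ (dil a v)`. -/
theorem hasDerivAt_kern {φ : E n × ℝ → ℝ} (hφ : ContDiff ℝ ∞ φ) (z w : E n × ℝ) {ρ : ℝ}
    (hρ : ρ ≠ 0) :
    HasDerivAt (fun ρ => kern φ z ρ w) (-(ρ⁻¹ * kern (divKern φ) z ρ w)) ρ := by
  set v := w - z with hv
  have h1 : ∀ a : ℝ, HasDerivAt (fun a : ℝ => dil a v) (v.1, 2 * a * v.2) a := fun a => by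
    simp only [dil_apply]
    refine HasDerivAt.prodMk ?_ ?_
    · simpa using (hasDerivAt_id a).smul_const v.1
    · simpa using (hasDerivAt_pow 2 a).mul_const v.2
  have h2 : ∀ a : ℝ, a ≠ 0 → HasDerivAt (fun a : ℝ => a ^ (n + 2) * φ (dil a v))
      (a ^ (n + 1) * divKern φ (dil a v)) a := fun a ha => by
    have h3 := ((hφ.differentiable (by simp)) (dil a v)).hasFDerivAt.comp_hasDerivAt a (h1 a)
    have h4 : ((dil a v).1, 2 * (dil a v).2) = a • (v.1, 2 * a * v.2) := by
      ext
      · simp [dil_apply]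
      · simp [dil_apply]
        ring
    have h5 := (hasDerivAt_pow (n + 2) a).fun_mul h3
    refine h5.congr_deriv ?_
    rw [divKern, h4, map_smul, smul_eq_mul]
    simp only [Function.comp]
    push_cast
    ring
  have h5 := (h2 ρ⁻¹ (inv_ne_zero hρ)).comp ρ (hasDerivAt_inv hρ)
  have h6 : ρ⁻¹ ^ (n + 1) * divKern φ (dil ρ⁻¹ v) * -(ρ ^ 2)⁻¹ =
      -(ρ⁻¹ * kern (divKern φ) z ρ w) := by
    rw [kern]
    ring
  rw [← h6]
  exact h5

/-- The field `(y, 2s)` has divergence `n + 2`, so `divKern φ` is the divergence of `φ` times this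
field. Being a divergence is what lets the scale derivative of an average be integrated by parts
onto `u`. -/
theorem divKern_eq {φ : E n × ℝ → ℝ} (hφ : ContDiff ℝ ∞ φ) (y : E n × ℝ) :
    divKern φ y = (∑ k, fderiv ℝ (fun y : E n × ℝ => y.1 k * φ y) y (dirX k)) +
      2 * fderiv ℝ (fun y : E n × ℝ => y.2 * φ y) y dirT := by
  have hd := (hφ.differentiable (by simp)) y
  have hX : ∀ k : Fin n, fderiv ℝ (fun y : E n × ℝ => y.1 k * φ y) y (dirX k) =
      φ y + y.1 k * fderiv ℝ φ y (dirX k) := fun k => by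
    have h1 : HasFDerivAt (fun y : E n × ℝ => y.1 k)
        ((EuclideanSpace.proj k).comp (ContinuousLinearMap.fst ℝ (E n) ℝ)) y :=
      ((EuclideanSpace.proj k).comp (ContinuousLinearMap.fst ℝ (E n) ℝ)).hasFDerivAt
    rw [(h1.fun_mul hd.hasFDerivAt).fderiv]
    simp [dirX]
    ring
  have hT : fderiv ℝ (fun y : E n × ℝ => y.2 * φ y) y dirT = φ y + y.2 * fderiv ℝ φ y dirT := by
    rw [(hasFDerivAt_snd.fun_mul hd.hasFDerivAt).fderiv]
    simp [dirT]
    ring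
  have hy : (y.1, 2 * y.2) = (∑ k, y.1 k • dirX k) + (2 * y.2) • dirT := by
    ext k
    · simp [dirX, dirT, Prod.fst_sum, Pi.single_apply]
    · simp [dirX, dirT, Prod.snd_sum]
  simp only [hX, hT, divKern]
  rw [hy, map_add, map_sum, Finset.sum_add_distrib]
  simp
  ring

theorem IsTestIn.divKern {U : Set (E n × ℝ)} {φ : E n × ℝ → ℝ} (hφ : IsTestIn U φ) :
    IsTestIn U (divKern φ) := by
  have h1 : ContDiff ℝ ∞ fun y => fderiv ℝ φ y (y.1, 2 * y.2) :=
    (hφ.1.fderiv_right (m := ∞) (by simp)).clm_apply (by fun_prop)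
  have hs : Function.support (ParabolicSobolev.divKern φ) ⊆ tsupport φ := fun y hy => by
    by_contra hc
    refine hy ?_
    have h2 : fderiv ℝ φ y = 0 :=
      image_eq_zero_of_notMem_tsupport fun h => hc (tsupport_fderiv_subset ℝ h)
    simp [ParabolicSobolev.divKern, h2, image_eq_zero_of_notMem_tsupport hc]
  exact ⟨(contDiff_const.mul hφ.1).add h1,
    hφ.2.1.mono' hs, (closure_minimal hs (isClosed_tsupport φ)).trans hφ.2.2⟩

end Kernels

/-! ### Cones in the domain and patches of the cylinder -/

section Geometry

variable {n : ℕ} {Ω : Opens (E n)} {T : ℝ}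

/-- At an interior point a small ball suffices. At a boundary point, a step `τ (e + v)` raises the
height by at least `τ (1 - ‖v‖)`, while the graph rises by at most `2 K τ ‖v‖`; the bound `‖v‖ < 1 /
(2 K + 1)` keeps the point above the graph. -/
theorem HasLipschitzBoundary.exists_cone (hΩ : HasLipschitzBoundary (Ω : Set (E n))) {x₀ : E n}
    (hx₀ : x₀ ∈ closure (Ω : Set (E n))) :
    ∃ U : Set (E n), IsOpen U ∧ x₀ ∈ U ∧ ∃ (e : E n) (ε h : ℝ), 0 < ε ∧ 0 < h ∧
      ∀ x ∈ U, x ∈ Ω → ∀ τ : ℝ, 0 < τ → τ ≤ h → ∀ y ∈ Metric.ball e ε, x + τ • y ∈ Ω := by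
  by_cases hx : x₀ ∈ (Ω : Set (E n))
  · obtain ⟨δ, hδ, hb⟩ := Metric.isOpen_iff.1 Ω.isOpen x₀ hx
    refine ⟨Metric.ball x₀ (δ / 2), Metric.isOpen_ball, Metric.mem_ball_self (by positivity), 0, 1,
      δ / 2, one_pos, by positivity, fun x hxU _ τ hτ hτh y hy => hb ?_⟩
    rw [mem_ball_zero_iff] at hy
    rw [Metric.mem_ball, dist_eq_norm] at hxU ⊢
    have h1 : x + τ • y - x₀ = (x - x₀) + τ • y := by abel
    have h2 : ‖τ • y‖ ≤ δ / 2 := by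
      rw [norm_smul, Real.norm_eq_abs, abs_of_pos hτ]
      nlinarith [norm_nonneg y]
    rw [h1]
    linarith [norm_add_le (x - x₀) (τ • y)]
  · have hf : x₀ ∈ frontier (Ω : Set (E n)) := by
      rw [Ω.isOpen.frontier_eq]
      exact ⟨hx₀, hx⟩
    obtain ⟨e, γ, K, ρ, he, hγ, hρ, hloc⟩ := hΩ x₀ hf
    have hε1 : 1 / (2 * (K : ℝ) + 1) ≤ 1 := by
      rw [div_le_one (by positivity)]
      linarith [K.coe_nonneg]
    -- Since `‖e + v‖ ≤ 2`, the limit `τ ≤ ρ / 4` moves points of the half ball by at most `ρ / 2`,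
    -- within the range of the graph description.
    refine ⟨Metric.ball x₀ (ρ / 2), Metric.isOpen_ball, Metric.mem_ball_self (by positivity), e,
      1 / (2 * K + 1), ρ / 4, by positivity, by positivity, fun x hxU hxΩ τ hτ hτh y hy => ?_⟩
    obtain ⟨v, rfl⟩ : ∃ v, y = e + v := ⟨y - e, by abel⟩
    have hv : ‖v‖ < 1 / (2 * K + 1) := by simpa [dist_eq_norm] using hy
    have hv1 : (2 * K + 1) * ‖v‖ < 1 := by
      rw [lt_div_iff₀ (by positivity)] at hv
      linarith
    have hx1 : x ∈ Metric.ball x₀ ρ := Metric.ball_subset_ball (by linarith) hxU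
    have hy1 : x + τ • (e + v) ∈ Metric.ball x₀ ρ := by
      rw [Metric.mem_ball, dist_eq_norm] at hxU ⊢
      have h1 : x + τ • (e + v) - x₀ = (x - x₀) + τ • (e + v) := by abel
      have h2 : ‖τ • (e + v)‖ ≤ ρ / 2 := by
        rw [norm_smul, Real.norm_eq_abs, abs_of_pos hτ]
        have h3 : ‖e + v‖ ≤ 2 := (norm_add_le e v).trans (by rw [he]; linarith)
        nlinarith [norm_nonneg (e + v)]
      rw [h1]
      linarith [norm_add_le (x - x₀) (τ • (e + v))]
    have hin : |inner ℝ e v| ≤ ‖v‖ := by simpa [he] using abs_real_inner_le_norm e v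
    have hx2 := (hloc x hx1).1 hxΩ
    refine (hloc _ hy1).2 ?_
    have hee : inner ℝ e e = (1 : ℝ) := by rw [real_inner_self_eq_norm_sq, he]; norm_num
    have hie : inner ℝ e (x + τ • (e + v)) = inner ℝ e x + τ * (1 + inner ℝ e v) := by
      rw [inner_add_right, inner_smul_right, inner_add_right, hee]
    have hdist := hγ.dist_le_mul (x + τ • (e + v) - inner ℝ e (x + τ • (e + v)) • e)
      (x - inner ℝ e x • e)
    have hdiff : x + τ • (e + v) - inner ℝ e (x + τ • (e + v)) • e - (x - inner ℝ e x • e) =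
        τ • (v - inner ℝ e v • e) := by
      rw [hie]
      module
    rw [dist_eq_norm, dist_eq_norm, hdiff, norm_smul, Real.norm_eq_abs, Real.norm_eq_abs,
      abs_of_pos hτ] at hdist
    have hproj : ‖v - inner ℝ e v • e‖ ≤ 2 * ‖v‖ := by
      refine (norm_sub_le _ _).trans ?_
      rw [norm_smul, he, Real.norm_eq_abs]
      linarith
    have h5 : (K : ℝ) * (τ * ‖v - inner ℝ e v • e‖) ≤ K * (τ * (2 * ‖v‖)) := by gcongr
    have h6 := (abs_le.1 hin).1
    have h7 := le_abs_self (γ (x + τ • (e + v) - inner ℝ e (x + τ • (e + v)) • e) -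
      γ (x - inner ℝ e x • e))
    rw [hie] at *
    nlinarith [mul_pos hτ (sub_pos.2 hv1), mul_nonneg hτ.le (sub_nonneg.2 h6)]

/-- At every point of `P`, the small parabolic dilates of `U` lie in the open cylinder. -/
def IsPatch (Ω : Opens (E n)) (T : ℝ) (P U : Set (E n × ℝ)) (h : ℝ) : Prop :=
  ∀ z ∈ P, ∀ ρ : ℝ, 0 < ρ → ρ ≤ h → ∀ y ∈ U, z + dil ρ y ∈ (Ω : Set (E n)) ×ˢ Set.Ioo 0 T

/-- Kernels look forward in time from the lower half of the cylinder and backward from the upper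
half, which includes the final time `T`. The time coordinate of the kernel has modulus below `2` and
`ρ ^ 2 ≤ T / 4`, so the shift is less than `T / 2`. -/
theorem HasLipschitzBoundary.exists_isPatch (hΩ : HasLipschitzBoundary (Ω : Set (E n)))
    (hT : 0 < T) {x₀ : E n} (hx₀ : x₀ ∈ closure (Ω : Set (E n))) :
    ∃ U : Set (E n), IsOpen U ∧ x₀ ∈ U ∧ ∃ (e : E n) (ε h : ℝ), 0 < ε ∧ 0 < h ∧ h ≤ 1 ∧
      IsPatch Ω T ((U ∩ Ω) ×ˢ Set.Ioc 0 (T / 2)) (Metric.ball (e, 1) ε) h ∧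
      IsPatch Ω T ((U ∩ Ω) ×ˢ Set.Ioc (T / 2) T) (Metric.ball (e, -1) ε) h := by
  obtain ⟨U, hU, hxU, e, ε, h, hε, hh, hc⟩ := hΩ.exists_cone hx₀
  have hT4 : 0 < T / 4 := by positivity
  have hsq : ∀ ρ : ℝ, 0 < ρ → ρ ≤ min h (min 1 (T / 4)) → ρ ^ 2 ≤ T / 4 := fun ρ h0 h1 => by
    have h2 : ρ ≤ 1 := h1.trans ((min_le_right _ _).trans (min_le_left _ _))
    have h3 : ρ ≤ T / 4 := h1.trans ((min_le_right _ _).trans (min_le_right _ _))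
    nlinarith
  refine ⟨U, hU, hxU, e, min ε 1, min h (min 1 (T / 4)), by positivity, by positivity,
    (min_le_right _ _).trans (min_le_left _ _), ?_, ?_⟩
  all_goals
    rintro z ⟨⟨hzU, hzΩ⟩, hz1, hz2⟩ ρ hρ hρh y hy
    rw [Metric.mem_ball, Prod.dist_eq, max_lt_iff] at hy
    refine ⟨hc z.1 hzU hzΩ ρ hρ (hρh.trans (min_le_left _ _)) y.1
      (hy.1.trans_le (min_le_left _ _)), ?_⟩
    have h1 := abs_lt.1 (hy.2.trans_le (min_le_right _ _))
    have h2 := hsq ρ hρ hρh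
    have h3 : 0 < ρ ^ 2 := by positivity
    simp only [Prod.snd_add, dil_apply, Set.mem_Ioo]
    constructor <;> nlinarith

end Geometry

/-! ### Scale derivatives of averages -/

section WeakDerivatives

variable {n : ℕ} {Ω : Opens (E n)} {T : ℝ} {p : ℝ≥0∞} [Fact (1 ≤ p)] {μ : Measure (E n × ℝ)}
  {U : Set (E n × ℝ)} {φ ψ : E n × ℝ → ℝ} {f : E n × ℝ → ℝ}

theorem integrable_mul_kern (hf : Integrable f μ) (hψ : IsTestIn U ψ) (z : E n × ℝ) (ρ : ℝ) :
    Integrable (fun w => f w * kern ψ z ρ w) μ := by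
  obtain ⟨B, hB0, hB⟩ := hψ.exists_bound
  refine hf.mul_bdd (c := |ρ⁻¹ ^ (n + 2)| * B)
    (contDiff_kern hψ.1 z ρ).continuous.aestronglyMeasurable (Filter.Eventually.of_forall fun w => ?_)
  rw [Real.norm_eq_abs, kern, abs_mul]
  gcongr
  exact hB _

theorem hasDerivAt_integral_mul_kern (hf : Integrable f μ) (hφ : IsTestIn U φ) (z : E n × ℝ)
    {ρ : ℝ} (hρ : 0 < ρ) :
    HasDerivAt (fun ρ => ∫ w, f w * kern φ z ρ w ∂μ)
      (-(ρ⁻¹ * ∫ w, f w * kern (divKern φ) z ρ w ∂μ)) ρ := by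
  obtain ⟨B, hB0, hB⟩ := hφ.divKern.exists_bound
  have h := (hasDerivAt_integral_of_dominated_loc_of_deriv_le (μ := μ)
    (F := fun ρ w => f w * kern φ z ρ w)
    (F' := fun ρ w => f w * -(ρ⁻¹ * kern (divKern φ) z ρ w))
    -- Differentiation under the integral is justified on scales above `ρ / 2`, where the powers of
    -- the inverse scale are bounded.
    (bound := fun w => |f w| * ((ρ / 2)⁻¹ * ((ρ / 2)⁻¹ ^ (n + 2) * B)))
    (Ioi_mem_nhds (half_lt_self hρ))
    (Filter.Eventually.of_forall fun ρ => (integrable_mul_kern hf hφ z ρ).aestronglyMeasurable)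
    (integrable_mul_kern hf hφ z ρ)
    (hf.aestronglyMeasurable.mul
      ((contDiff_const.mul (contDiff_kern hφ.divKern.1 z ρ)).neg.continuous.aestronglyMeasurable))
    (Filter.Eventually.of_forall fun w x hx => ?_) (hf.abs.mul_const _)
    (Filter.Eventually.of_forall fun w x hx =>
      (hasDerivAt_kern hφ.1 z w ((half_pos hρ).trans hx).ne').const_mul (f w))).2
  · refine h.congr_deriv ?_
    rw [← integral_const_mul, ← integral_neg]
    refine integral_congr_ae (Filter.Eventually.of_forall fun w => ?_)
    simp only
    ring
  · have hx0 : 0 < x := (half_pos hρ).trans hx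
    have hxi : x⁻¹ ≤ (ρ / 2)⁻¹ := inv_anti₀ (half_pos hρ) hx.le
    have hxi0 : 0 < x⁻¹ := inv_pos.2 hx0
    rw [Real.norm_eq_abs, abs_mul, abs_neg, abs_mul, kern, abs_mul, abs_of_pos hxi0,
      abs_of_pos (pow_pos hxi0 _)]
    gcongr
    exact hB _

theorem integral_mul_kern_divKern (hf : Integrable f μ) (hφ : IsTestIn U φ) (z : E n × ℝ)
    (ρ : ℝ) :
    ∫ w, f w * kern (divKern φ) z ρ w ∂μ =
      (∑ k, ∫ w, f w * kern
        (fun y => fderiv ℝ (fun y : E n × ℝ => y.1 k * φ y) y (dirX k)) z ρ w ∂μ) +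
      2 * ∫ w, f w * kern (fun y => fderiv ℝ (fun y : E n × ℝ => y.2 * φ y) y dirT) z ρ w ∂μ := by
  have hX : ∀ k : Fin n, IsTestIn U
      fun y => fderiv ℝ (fun y : E n × ℝ => y.1 k * φ y) y (dirX k) := fun k =>
    (hφ.mul_left (a := fun y => y.1 k) (by fun_prop)).fderiv_apply _
  have hT : IsTestIn U fun y => fderiv ℝ (fun y : E n × ℝ => y.2 * φ y) y dirT :=
    (hφ.mul_left (a := fun y => y.2) (by fun_prop)).fderiv_apply _
  rw [← integral_finsetSum _ fun k _ => integrable_mul_kern hf (hX k) z ρ, ← integral_const_mul,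
    ← integral_add (integrable_finsetSum _ fun k _ => integrable_mul_kern hf (hX k) z ρ)
      ((integrable_mul_kern hf hT z ρ).const_mul 2)]
  refine integral_congr_ae (Filter.Eventually.of_forall fun w => ?_)
  simp only [kern, divKern_eq hφ.1, ← Finset.mul_sum]
  ring

end WeakDerivatives

/-! ### Integration by parts against rescaled kernels -/

section DerivativeBounds

variable {n : ℕ} {Ω : Opens (E n)} {T : ℝ} {p : ℝ≥0∞} [Fact (1 ≤ p)]
  {U : Set (E n × ℝ)} {φ ψ ζ : E n × ℝ → ℝ}

theorem isFiniteMeasure_cylMeasure (hΩ : Bornology.IsBounded (Ω : Set (E n))) (T : ℝ) :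
    IsFiniteMeasure (cylMeasure Ω T) :=
  isFiniteMeasure_restrict.2 (hΩ.prod (Metric.isBounded_Ioc 0 T)).measure_lt_top.ne

theorem IsTest.fderiv_apply (h : IsTest Ω T ζ) (v : E n × ℝ) :
    IsTest Ω T fun y => fderiv ℝ ζ y v :=
  IsTestIn.fderiv_apply h v

theorem fderiv_fderiv_apply_comm (h : ContDiff ℝ ∞ ζ) (z v w : E n × ℝ) :
    fderiv ℝ (fun y => fderiv ℝ ζ y w) z v = fderiv ℝ (fun y => fderiv ℝ ζ y v) z w := by
  have hd : DifferentiableAt ℝ (fderiv ℝ ζ) z :=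
    (h.fderiv_right (m := ∞) (by simp)).differentiable (by simp) z
  have h1 : ∀ v w, fderiv ℝ (fun y => fderiv ℝ ζ y w) z v = fderiv ℝ (fderiv ℝ ζ) z v w :=
    fun v w => by
      rw [fderiv_clm_apply hd (differentiableAt_const w)]
      simp
  rw [h1, h1]
  exact (h.contDiffAt.isSymmSndFDerivAt
    (by rw [minSmoothness_of_isRCLikeNormedField]; exact WithTop.coe_le_coe.2 le_top)) v w

/-- The sum of the moduli of the weak derivatives which enter the norm of `W^{2,1}_p`. -/
noncomputable def derivSum (u : W21 Ω T p) (w : E n × ℝ) : ℝ≥0∞ := ∑ i, ‖u.wderiv i w‖ₑ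

theorem measurable_derivSum (u : W21 Ω T p) : Measurable (derivSum u) :=
  Finset.measurable_sum _ fun i _ => (Lp.stronglyMeasurable (u.wderiv i)).measurable.enorm

theorem eLpNorm_derivSum_le (u : W21 Ω T p) :
    eLpNorm (derivSum u) p (cylMeasure Ω T) ≤ ENNReal.ofReal ‖u‖ := by
  have h1 : derivSum u = ∑ i, fun w => ‖u.wderiv i w‖ₑ := by
    ext w
    simp [derivSum]
  rw [h1]
  refine (eLpNorm_sum_le (fun i _ =>
    (Lp.stronglyMeasurable (u.wderiv i)).measurable.enorm.aestronglyMeasurable) Fact.out).trans ?_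
  have h2 : ∀ i, eLpNorm (fun w => ‖u.wderiv i w‖ₑ) p (cylMeasure Ω T) =
      ENNReal.ofReal ‖u.wderiv i‖ := fun i => by
    rw [eLpNorm_enorm, Lp.norm_def, ENNReal.ofReal_toReal (Lp.eLpNorm_ne_top _)]
  simp only [h2]
  rw [← ENNReal.ofReal_sum_of_nonneg fun i _ => norm_nonneg _, Sobolev.norm_eq u]
  exact ENNReal.ofReal_le_ofReal (le_add_of_nonneg_left (norm_nonneg _))

theorem integral_toLp_mul_fderiv_dirX (u : W21 Ω T p) (hζ : IsTest Ω T ζ) (k : Fin n) :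
    ∫ w, u.toLp w * fderiv ℝ ζ w (dirX k) ∂(cylMeasure Ω T) =
      -∫ w, u.wderiv (Sum.inr (Sum.inl k)) w * ζ w ∂(cylMeasure Ω T) := by
  simpa [derivs21, iterDeriv] using u.hasWeakDeriv (Sum.inr (Sum.inl k)) ζ hζ

theorem integral_toLp_mul_fderiv_dirT (u : W21 Ω T p) (hζ : IsTest Ω T ζ) :
    ∫ w, u.toLp w * fderiv ℝ ζ w dirT ∂(cylMeasure Ω T) =
      -∫ w, u.wderiv (Sum.inl ()) w * ζ w ∂(cylMeasure Ω T) := by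
  simpa [derivs21, iterDeriv] using u.hasWeakDeriv (Sum.inl ()) ζ hζ

theorem integral_wderiv_mul_fderiv_dirX (u : W21 Ω T p) (hζ : IsTest Ω T ζ) (k l : Fin n) :
    ∫ w, u.wderiv (Sum.inr (Sum.inl l)) w * fderiv ℝ ζ w (dirX k) ∂(cylMeasure Ω T) =
      -∫ w, u.wderiv (Sum.inr (Sum.inr (k, l))) w * ζ w ∂(cylMeasure Ω T) := by
  have h1 := integral_toLp_mul_fderiv_dirX u (hζ.fderiv_apply (dirX k)) l
  have h2 : ∫ w, u.toLp w * fderiv ℝ (fun y => fderiv ℝ ζ y (dirX k)) w (dirX l)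
      ∂(cylMeasure Ω T) =
      ∫ w, u.wderiv (Sum.inr (Sum.inr (k, l))) w * ζ w ∂(cylMeasure Ω T) := by
    simpa [derivs21, iterDeriv] using u.hasWeakDeriv (Sum.inr (Sum.inr (k, l))) ζ hζ
  rw [← h2, h1, neg_neg]

/-- No mixed derivative `u_{x_l t}` is available in `W^{2,1}_p`. Both sides equal minus the integral
of `u` against the mixed second derivative of `ζ`, which is symmetric. -/
theorem integral_wderiv_mul_fderiv_dirT (u : W21 Ω T p) (hζ : IsTest Ω T ζ) (l : Fin n) :
    ∫ w, u.wderiv (Sum.inr (Sum.inl l)) w * fderiv ℝ ζ w dirT ∂(cylMeasure Ω T) =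
      ∫ w, u.wderiv (Sum.inl ()) w * fderiv ℝ ζ w (dirX l) ∂(cylMeasure Ω T) := by
  have h1 := integral_toLp_mul_fderiv_dirX u (hζ.fderiv_apply dirT) l
  have h2 := integral_toLp_mul_fderiv_dirT u (hζ.fderiv_apply (dirX l))
  simp only [fderiv_fderiv_apply_comm hζ.1 _ (dirX l) dirT] at h1
  linarith

section Rescaled

variable {z : E n × ℝ} {ρ : ℝ}

theorem integral_mul_kern_fderiv_dirX (f : E n × ℝ → ℝ) (μ : Measure (E n × ℝ))
    (hψ : ContDiff ℝ ∞ ψ) (hρ : ρ ≠ 0) (k : Fin n) :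
    ∫ w, f w * kern (fun y => fderiv ℝ ψ y (dirX k)) z ρ w ∂μ =
      ρ * ∫ w, f w * fderiv ℝ (kern ψ z ρ) w (dirX k) ∂μ := by
  rw [← integral_const_mul]
  refine integral_congr_ae (Filter.Eventually.of_forall fun w => ?_)
  simp only [fderiv_kern_dirX hψ]
  field_simp

theorem integral_mul_kern_fderiv_dirT (f : E n × ℝ → ℝ) (μ : Measure (E n × ℝ))
    (hψ : ContDiff ℝ ∞ ψ) (hρ : ρ ≠ 0) :
    ∫ w, f w * kern (fun y => fderiv ℝ ψ y dirT) z ρ w ∂μ =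
      ρ ^ 2 * ∫ w, f w * fderiv ℝ (kern ψ z ρ) w dirT ∂μ := by
  rw [← integral_const_mul]
  refine integral_congr_ae (Filter.Eventually.of_forall fun w => ?_)
  simp only [fderiv_kern_dirT hψ]
  field_simp

/-- The factor `c` is the gain from one integration by parts: `ρ` in space, `ρ ^ 2` in time, the
latter at most `ρ` once `ρ ≤ 1`. -/
theorem enorm_mul_integral_wderiv_mul_kern_le {R B : ℝ} (hR : tsupport ψ ⊆ Metric.closedBall 0 R)
    (hB : ∀ y, |ψ y| ≤ B) (hρ : 0 < ρ) (u : W21 Ω T p)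
    (i : Unit ⊕ Fin n ⊕ (Fin n × Fin n)) {c : ℝ} (hc : |c| ≤ ρ) :
    ‖c * ∫ w, u.wderiv i w * kern ψ z ρ w ∂(cylMeasure Ω T)‖ₑ ≤
      ENNReal.ofReal (B * (ρ * ρ⁻¹ ^ (n + 2))) *
        ∫⁻ w in {w | (z, w) ∈ boxRel n R ρ}, derivSum u w ∂(cylMeasure Ω T) := by
  rw [enorm_mul]
  have h1 : ‖c‖ₑ ≤ ENNReal.ofReal ρ := by
    rw [Real.enorm_eq_ofReal_abs]
    exact ENNReal.ofReal_le_ofReal hc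
  refine (mul_le_mul' h1 (enorm_integral_mul_kern_le hR hB z hρ _ _)).trans ?_
  rw [← mul_assoc, ← ENNReal.ofReal_mul hρ.le, mul_left_comm]
  gcongr with w
  exact Finset.single_le_sum (f := fun i => ‖u.wderiv i w‖ₑ) (fun _ _ => zero_le)
    (Finset.mem_univ i)

theorem enorm_sum_add_two_mul_le {a : Fin n → ℝ} {b : ℝ} {B c : ℝ} {I : ℝ≥0∞}
    (ha : ∀ k, ‖a k‖ₑ ≤ ENNReal.ofReal (B * c) * I) (hb : ‖b‖ₑ ≤ ENNReal.ofReal (B * c) * I) :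
    ‖(∑ k, a k) + 2 * b‖ₑ ≤ ENNReal.ofReal ((n + 2) * B * c) * I := by
  calc ‖(∑ k, a k) + 2 * b‖ₑ ≤ (∑ k : Fin n, ENNReal.ofReal (B * c) * I) +
        2 * (ENNReal.ofReal (B * c) * I) := by
        refine (enorm_add_le _ _).trans (add_le_add ?_ ?_)
        · exact (enorm_sum_le _ _).trans (Finset.sum_le_sum fun k _ => ha k)
        · rw [enorm_mul]
          gcongr
          simp [Real.enorm_eq_ofReal_abs]
    _ = ENNReal.ofReal ((n + 2) * B * c) * I := by
        rw [mul_assoc (n + 2 : ℝ), ENNReal.ofReal_mul (p := (n + 2 : ℝ)) (by positivity),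
          ENNReal.ofReal_add (by positivity) (by positivity)]
        simp
        ring

end Rescaled

variable [IsFiniteMeasure (cylMeasure Ω T)]

theorem integrable_Lp (f : Lp ℝ p (cylMeasure Ω T)) : Integrable f (cylMeasure Ω T) :=
  (Lp.memLp f).integrable Fact.out

/-- Each term of the divergence is integrated by parts onto `u`: the space terms produce `ρ u_{x_k}`
and the time term `ρ ^ 2 u_t`. -/
theorem exists_enorm_integral_toLp_mul_kern_divKern_le {R : ℝ} (hφ : IsTestIn U φ)
    (hR : U ⊆ Metric.closedBall 0 R) :
    ∃ C : ℝ, 0 ≤ C ∧ ∀ (u : W21 Ω T p) (z : E n × ℝ) (ρ : ℝ), 0 < ρ → ρ ≤ 1 →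
      (∀ y ∈ U, z + dil ρ y ∈ (Ω : Set (E n)) ×ˢ Set.Ioo 0 T) →
      ‖∫ w, u.toLp w * kern (divKern φ) z ρ w ∂(cylMeasure Ω T)‖ₑ ≤
        ENNReal.ofReal (C * (ρ * ρ⁻¹ ^ (n + 2))) *
          ∫⁻ w in {w | (z, w) ∈ boxRel n R ρ}, derivSum u w ∂(cylMeasure Ω T) := by
  have hX : ∀ k : Fin n, IsTestIn U fun y : E n × ℝ => y.1 k * φ y := fun k =>
    hφ.mul_left (a := fun y => y.1 k) (by fun_prop)
  have hT : IsTestIn U fun y : E n × ℝ => y.2 * φ y :=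
    hφ.mul_left (a := fun y => y.2) (by fun_prop)
  choose BX hBX0 hBX using fun k => (hX k).exists_bound
  obtain ⟨BT, hBT0, hBT⟩ := hT.exists_bound
  set B := (∑ k, BX k) + BT with hB
  have hB0 : 0 ≤ B := add_nonneg (Finset.sum_nonneg fun k _ => hBX0 k) hBT0
  refine ⟨(n + 2) * B, by positivity, fun u z ρ hρ hρ1 hz => ?_⟩
  rw [integral_mul_kern_divKern (integrable_Lp _) hφ]
  refine enorm_sum_add_two_mul_le (fun k => ?_) ?_
  · rw [integral_mul_kern_fderiv_dirX _ _ (hX k).1 hρ.ne',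
      integral_toLp_mul_fderiv_dirX u ((hX k).isTest_kern hρ.ne' hz), mul_neg, enorm_neg]
    refine enorm_mul_integral_wderiv_mul_kern_le ((hX k).2.2.trans hR) (fun y => ?_) hρ u _
      (abs_of_pos hρ).le
    exact (hBX k y).trans ((Finset.single_le_sum (fun k _ => hBX0 k) (Finset.mem_univ k)).trans
      (le_add_of_nonneg_right hBT0))
  · rw [integral_mul_kern_fderiv_dirT _ _ hT.1 hρ.ne',
      integral_toLp_mul_fderiv_dirT u (hT.isTest_kern hρ.ne' hz), mul_neg, enorm_neg]
    refine enorm_mul_integral_wderiv_mul_kern_le (hT.2.2.trans hR) (fun y => ?_) hρ u _ ?_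
    · exact (hBT y).trans (le_add_of_nonneg_left (Finset.sum_nonneg fun k _ => hBX0 k))
    · rw [abs_of_pos (by positivity)]
      nlinarith

/-- The space terms produce `ρ u_{x_k x_l}`. In the time term the derivative is traded for `u_t`
against an `x_l`-derivative of the kernel. -/
theorem exists_enorm_integral_wderiv_mul_kern_divKern_le {R : ℝ} (hφ : IsTestIn U φ)
    (hR : U ⊆ Metric.closedBall 0 R) (l : Fin n) :
    ∃ C : ℝ, 0 ≤ C ∧ ∀ (u : W21 Ω T p) (z : E n × ℝ) (ρ : ℝ), 0 < ρ → ρ ≤ 1 →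
      (∀ y ∈ U, z + dil ρ y ∈ (Ω : Set (E n)) ×ˢ Set.Ioo 0 T) →
      ‖∫ w, u.wderiv (Sum.inr (Sum.inl l)) w * kern (divKern φ) z ρ w ∂(cylMeasure Ω T)‖ₑ ≤
        ENNReal.ofReal (C * (ρ * ρ⁻¹ ^ (n + 2))) *
          ∫⁻ w in {w | (z, w) ∈ boxRel n R ρ}, derivSum u w ∂(cylMeasure Ω T) := by
  have hX : ∀ k : Fin n, IsTestIn U fun y : E n × ℝ => y.1 k * φ y := fun k =>
    hφ.mul_left (a := fun y => y.1 k) (by fun_prop)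
  have hT : IsTestIn U fun y : E n × ℝ => y.2 * φ y :=
    hφ.mul_left (a := fun y => y.2) (by fun_prop)
  have hTl := hT.fderiv_apply (dirX l)
  choose BX hBX0 hBX using fun k => (hX k).exists_bound
  obtain ⟨BT, hBT0, hBT⟩ := hTl.exists_bound
  set B := (∑ k, BX k) + BT with hB
  have hB0 : 0 ≤ B := add_nonneg (Finset.sum_nonneg fun k _ => hBX0 k) hBT0
  refine ⟨(n + 2) * B, by positivity, fun u z ρ hρ hρ1 hz => ?_⟩
  rw [integral_mul_kern_divKern (integrable_Lp _) hφ]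
  refine enorm_sum_add_two_mul_le (fun k => ?_) ?_
  · rw [integral_mul_kern_fderiv_dirX _ _ (hX k).1 hρ.ne',
      integral_wderiv_mul_fderiv_dirX u ((hX k).isTest_kern hρ.ne' hz), mul_neg, enorm_neg]
    refine enorm_mul_integral_wderiv_mul_kern_le ((hX k).2.2.trans hR) (fun y => ?_) hρ u _
      (abs_of_pos hρ).le
    exact (hBX k y).trans ((Finset.single_le_sum (fun k _ => hBX0 k) (Finset.mem_univ k)).trans
      (le_add_of_nonneg_right hBT0))
  · have h1 := integral_mul_kern_fderiv_dirX (z := z) (u.wderiv (Sum.inl ())) (cylMeasure Ω T)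
      hT.1 hρ.ne' l
    rw [integral_mul_kern_fderiv_dirT _ _ hT.1 hρ.ne',
      integral_wderiv_mul_fderiv_dirT u (hT.isTest_kern hρ.ne' hz), pow_two, mul_assoc, ← h1]
    refine enorm_mul_integral_wderiv_mul_kern_le (hTl.2.2.trans hR) (fun y => ?_) hρ u _
      (abs_of_pos hρ).le
    exact (hBT y).trans (le_add_of_nonneg_left (Finset.sum_nonneg fun k _ => hBX0 k))

end DerivativeBounds

/-! ### Averages as approximate identities -/

section Averages

variable {n : ℕ} {μ : Measure (E n × ℝ)} {U P : Set (E n × ℝ)} {φ f : E n × ℝ → ℝ} {R h : ℝ}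

/-- The average of `f` against `φ` rescaled to scale `ρ`. -/
noncomputable def avg (μ : Measure (E n × ℝ)) (φ f : E n × ℝ → ℝ) (ρ : ℝ) (z : E n × ℝ) : ℝ :=
  ∫ w, f w * kern φ z ρ w ∂μ

theorem stronglyMeasurable_avg [SFinite μ] (hφ : Continuous φ) (hf : StronglyMeasurable f)
    (ρ : ℝ) : StronglyMeasurable (avg μ φ f ρ) := by
  have h1 : Continuous fun x : (E n × ℝ) × (E n × ℝ) => kern φ x.1 ρ x.2 := by
    unfold kern
    fun_prop
  exact ((hf.comp_measurable measurable_snd).mul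
    h1.stronglyMeasurable).integral_prod_right' (ν := μ)

theorem integral_kern (hφ : IsTestIn U φ) (z : E n × ℝ) {ρ : ℝ} (hρ : 0 < ρ) :
    ∫ w, kern φ z ρ w = ∫ y, φ y := by
  have hInt : ∀ a : ℝ, a ≠ 0 → Integrable (fun y : E n × ℝ => φ (a • y.1, a ^ 2 * y.2)) := by
    intro a ha
    refine Continuous.integrable_of_hasCompactSupport (hφ.1.continuous.comp (by fun_prop)) ?_
    have h1 : Topology.IsClosedEmbedding (dil a : E n × ℝ → E n × ℝ) := by
      refine Topology.IsClosedEmbedding.of_continuous_injective_isClosedMap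
        (dil a).continuous (fun x y hxy => ?_) ?_
      · rw [← dil_inv_dil ha x, hxy, dil_inv_dil ha]
      · exact (Homeomorph.mk ⟨dil a, dil a⁻¹, dil_inv_dil ha, dil_dil_inv ha⟩
          (dil a).continuous (dil a⁻¹).continuous).isClosedMap
    exact hφ.2.1.comp_isClosedEmbedding h1
  have h1 : ∫ w, kern φ z ρ w = ∫ w, kern φ 0 ρ w := by
    rw [Measure.volume_eq_prod,
      ← integral_sub_right_eq_self (μ := (volume : Measure (E n)).prod volume) (kern φ 0 ρ) z]
    simp [kern]
  have hρi : ρ⁻¹ ≠ 0 := inv_ne_zero hρ.ne'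
  have hφi : Integrable φ := by simpa using hInt 1 one_ne_zero
  rw [h1]
  simp only [kern, sub_zero, dil_apply]
  rw [integral_const_mul, Measure.volume_eq_prod, integral_prod _ (hInt _ hρi),
    integral_prod _ hφi]
  have h2 : ∀ x : E n, ∫ t : ℝ, φ (ρ⁻¹ • x, ρ⁻¹ ^ 2 * t) = ρ ^ 2 * ∫ t, φ (ρ⁻¹ • x, t) := by
    intro x
    rw [Measure.integral_comp_mul_left (fun t => φ (ρ⁻¹ • x, t))]
    rw [← inv_pow, inv_inv, abs_of_pos (by positivity), smul_eq_mul]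
  simp only [h2]
  rw [integral_const_mul, Measure.integral_comp_smul _ (fun x : E n => ∫ t, φ (x, t)),
    finrank_euclideanSpace_fin, ← inv_pow, inv_inv, abs_of_pos (by positivity), smul_eq_mul]
  rw [inv_pow]
  field_simp
  ring

variable [IsFiniteMeasure μ]

/-- The kernel is at most `B ρ^{-(n+2)}` on boxes of volume at most `c ρ^{n+2}`, so the bound does
not depend on the scale. -/
theorem eLpNorm_avg_one_le (hμ : μ ≤ volume) (hφ : IsTestIn U φ)
    (hR : U ⊆ Metric.closedBall 0 R) (hR0 : 0 < R) :
    ∃ C : ℝ, 0 ≤ C ∧ ∀ f : E n × ℝ → ℝ, StronglyMeasurable f → ∀ ρ : ℝ, 0 < ρ →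
      eLpNorm (avg μ φ f ρ) 1 μ ≤ ENNReal.ofReal C * eLpNorm f 1 μ := by
  obtain ⟨B, hB0, hB⟩ := hφ.exists_bound
  obtain ⟨c, hc0, hc⟩ := volume_boxRel_le (n := n) hR0
  refine ⟨B * c, by positivity, fun f hf ρ hρ => ?_⟩
  have hS := (isClosed_boxRel (n := n) R ρ).measurableSet
  have hfm : Measurable fun w => ‖f w‖ₑ := hf.measurable.enorm
  have h1 : eLpNorm (avg μ φ f ρ) 1 μ ≤ ENNReal.ofReal (B * ρ⁻¹ ^ (n + 2)) *
      eLpNorm (fun z => ∫⁻ w in {w | (z, w) ∈ boxRel n R ρ}, ‖f w‖ₑ ∂μ) 1 μ :=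
    eLpNorm_le_mul_eLpNorm_of_ae_le_mul' (c := (B * ρ⁻¹ ^ (n + 2)).toNNReal)
      (Filter.Eventually.of_forall fun z => by
        rw [enorm_eq_self]
        exact enorm_integral_mul_kern_le (hφ.2.2.trans hR) hB z hρ f μ) 1
  have h2 := eLpNorm_setLIntegral_section_le (μ := μ) hS (boxRel_symm R ρ)
    (V := ENNReal.ofReal (c * ρ ^ (n + 2))) (by simp; positivity) ENNReal.ofReal_ne_top
    (fun z => (hμ _).trans (hc ρ hρ z)) le_rfl ENNReal.one_ne_top le_rfl hfm
  rw [eLpNorm_enorm] at h2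
  refine h1.trans ((mul_le_mul_right h2 _).trans_eq ?_)
  simp only [ENNReal.toReal_one, inv_one, sub_self, zero_add, ENNReal.rpow_one]
  rw [← mul_assoc, ← ENNReal.ofReal_mul (by positivity)]
  congr 2
  rw [inv_pow]
  field_simp

/-- By density: for a compactly supported continuous `g` the averages converge uniformly on `P`, and
the uniform `L^1` bound transfers this to `f`. -/
theorem exists_eLpNorm_avg_sub_le (hμ : μ ≤ volume) (hφ : IsTestIn U φ)
    (hR : U ⊆ Metric.closedBall 0 R) (hR0 : 0 < R) (hP : MeasurableSet P)
    (hone : ∀ z ∈ P, ∀ ρ : ℝ, 0 < ρ → ρ ≤ h → ∫ w, kern φ z ρ w ∂μ = 1)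
    (hf : StronglyMeasurable f) (hfi : Integrable f μ) {ε : ℝ≥0∞} (hε : ε ≠ 0) :
    ∃ ρ₀ : ℝ, 0 < ρ₀ ∧ ∀ ρ : ℝ, 0 < ρ → ρ ≤ ρ₀ → ρ ≤ h →
      eLpNorm (avg μ φ f ρ - f) 1 (μ.restrict P) ≤ ε := by
  obtain ⟨C, hC0, hC⟩ := eLpNorm_avg_one_le hμ hφ hR hR0
  obtain ⟨B, hB0, hB⟩ := hφ.exists_bound
  obtain ⟨c, hc0, hc⟩ := volume_boxRel_le (n := n) hR0
  have hε3 : ε / 3 ≠ 0 := (ENNReal.div_pos hε (by simp)).ne'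
  -- The error `f - g` enters twice, once averaged, with factor `C`, and once directly.
  obtain ⟨κ, hκ0, hκ⟩ : ∃ κ : ℝ≥0∞, κ ≠ 0 ∧ ENNReal.ofReal C * κ ≤ ε / 3 ∧ κ ≤ ε / 3 := by
    refine ⟨min (ε / 3 / ENNReal.ofReal C) (ε / 3), ?_, ?_, min_le_right _ _⟩
    · exact (lt_min (ENNReal.div_pos hε3 ENNReal.ofReal_ne_top) hε3.bot_lt).ne'
    · exact (mul_le_mul_right (min_le_left _ _) _).trans ENNReal.mul_div_le
  obtain ⟨g, hgc, hfg, hgcont, hgL⟩ :=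
    (memLp_one_iff_integrable.2 hfi).exists_hasCompactSupport_eLpNorm_sub_le ENNReal.one_ne_top hκ0
  have hgi : Integrable g μ := memLp_one_iff_integrable.1 hgL
  obtain ⟨η, hη0, hη⟩ : ∃ η : ℝ, 0 < η ∧
      ENNReal.ofReal (B * c) * ENNReal.ofReal η * μ P ≤ ε / 3 := by
    have hA : ENNReal.ofReal (B * c) * μ P ≠ ⊤ :=
      ENNReal.mul_ne_top ENNReal.ofReal_ne_top (measure_ne_top _ _)
    obtain ⟨η, hη0, hη⟩ := ENNReal.exists_nnreal_pos_mul_lt hA hε3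
    refine ⟨η, hη0, le_trans (le_of_eq ?_) hη.le⟩
    rw [ENNReal.ofReal_coe_nnreal]
    ring
  obtain ⟨δ, hδ0, hδ⟩ := Metric.uniformContinuous_iff.1
    (hgc.uniformContinuous_of_continuous hgcont) η hη0
  -- The first bound gives `R ρ² ≤ R ρ` and the second `R ρ < δ`, so the whole box lies within `δ`
  -- of its centre.
  refine ⟨min 1 (δ / (2 * R)), by positivity, fun ρ hρ hρ0 hρh => ?_⟩
  have hρ1 : ρ ≤ 1 := hρ0.trans (min_le_left _ _)
  have hρδ : R * ρ < δ := by
    have := hρ0.trans (min_le_right _ _)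
    rw [le_div_iff₀ (by positivity)] at this
    nlinarith
  have hbox : ∀ z w, (z, w) ∈ boxRel n R ρ → ‖g w - g z‖ₑ ≤ ENNReal.ofReal η := fun z w hw => by
    rw [Real.enorm_eq_ofReal_abs]
    refine ENNReal.ofReal_le_ofReal (le_of_lt ?_)
    refine hδ ?_
    rw [Prod.dist_eq, max_lt_iff, dist_eq_norm, Real.dist_eq]
    refine ⟨hw.1.trans_lt hρδ, hw.2.trans_lt (lt_of_le_of_lt ?_ hρδ)⟩
    have : ρ ^ 2 ≤ ρ := by nlinarith
    gcongr
  have hgP : ∀ z ∈ P, ‖(avg μ φ g ρ - g) z‖ₑ ≤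
      ENNReal.ofReal (B * c) * ENNReal.ofReal η := fun z hz => by
    have h1 : (avg μ φ g ρ - g) z = ∫ w, (g w - g z) * kern φ z ρ w ∂μ := by
      simp only [sub_mul]
      rw [integral_sub (integrable_mul_kern hgi hφ z ρ)
        (integrable_mul_kern (integrable_const (g z)) hφ z ρ), integral_const_mul,
        hone z hz ρ hρ hρh, mul_one]
      rfl
    rw [h1]
    refine (enorm_integral_mul_kern_le (hφ.2.2.trans hR) hB z hρ _ μ).trans ?_
    have hm : MeasurableSet {w | (z, w) ∈ boxRel n R ρ} :=
      measurable_prodMk_left (isClosed_boxRel (n := n) R ρ).measurableSet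
    calc _ ≤ ENNReal.ofReal (B * ρ⁻¹ ^ (n + 2)) *
          (ENNReal.ofReal η * ENNReal.ofReal (c * ρ ^ (n + 2))) := by
          gcongr
          refine (setLIntegral_mono' hm fun w hw => hbox z w hw).trans ?_
          rw [setLIntegral_const]
          gcongr
          exact (hμ _).trans (hc ρ hρ z)
      _ = ENNReal.ofReal (B * c) * ENNReal.ofReal η := by
          rw [mul_left_comm, ← ENNReal.ofReal_mul (by positivity), mul_comm]
          congr 2
          rw [inv_pow]
          field_simp
  have hsplit : avg μ φ f ρ - f = avg μ φ (f - g) ρ + (avg μ φ g ρ - g) - (f - g) := by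
    ext z
    have : avg μ φ (f - g) ρ z = avg μ φ f ρ z - avg μ φ g ρ z := by
      simp only [avg, Pi.sub_apply, sub_mul]
      exact integral_sub (integrable_mul_kern hfi hφ z ρ) (integrable_mul_kern hgi hφ z ρ)
    simp only [Pi.sub_apply, Pi.add_apply, this]
    ring
  have hgs := hgcont.stronglyMeasurable
  have hm1 := (stronglyMeasurable_avg (μ := μ) hφ.1.continuous (hf.sub hgs) ρ)
  have hm2 := (stronglyMeasurable_avg (μ := μ) hφ.1.continuous hgs ρ).sub hgs
  have hr : ∀ k : E n × ℝ → ℝ, eLpNorm k 1 (μ.restrict P) ≤ eLpNorm k 1 μ := fun k =>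
    eLpNorm_mono_measure _ Measure.restrict_le_self
  rw [hsplit]
  calc _ ≤ eLpNorm (avg μ φ (f - g) ρ + (avg μ φ g ρ - g)) 1 (μ.restrict P) +
        eLpNorm (f - g) 1 (μ.restrict P) :=
        eLpNorm_sub_le (hm1.add hm2).aestronglyMeasurable (hf.sub hgs).aestronglyMeasurable le_rfl
    _ ≤ eLpNorm (avg μ φ (f - g) ρ) 1 (μ.restrict P) +
        eLpNorm (avg μ φ g ρ - g) 1 (μ.restrict P) + eLpNorm (f - g) 1 (μ.restrict P) := by
        gcongr
        exact eLpNorm_add_le hm1.aestronglyMeasurable hm2.aestronglyMeasurable le_rfl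
    _ ≤ ε / 3 + ε / 3 + ε / 3 := by
        refine add_le_add (add_le_add ?_ ?_) ((hr _).trans (hfg.trans hκ.2))
        · exact ((hr _).trans (hC _ (hf.sub hgs) ρ hρ)).trans
            ((mul_le_mul_right hfg _).trans hκ.1)
        · rw [eLpNorm_one_eq_lintegral_enorm]
          exact ((setLIntegral_mono' hP hgP).trans_eq (setLIntegral_const _ _)).trans hη
    _ = ε := ENNReal.add_thirds ε

/-- The averages converge almost everywhere along a subsequence of any sequence of scales. -/
theorem exists_subseq_avg_tendsto (hμ : μ ≤ volume) (hφ : IsTestIn U φ)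
    (hR : U ⊆ Metric.closedBall 0 R) (hR0 : 0 < R) (hP : MeasurableSet P)
    (hone : ∀ z ∈ P, ∀ ρ : ℝ, 0 < ρ → ρ ≤ h → ∫ w, kern φ z ρ w ∂μ = 1)
    (hf : StronglyMeasurable f) (hfi : Integrable f μ) {s : ℕ → ℝ} (hs0 : ∀ j, 0 < s j)
    (hsh : ∀ j, s j ≤ h) (hs : Filter.Tendsto s Filter.atTop (nhds 0)) :
    ∃ ns : ℕ → ℕ, ∀ᵐ z ∂(μ.restrict P),
      Filter.Tendsto (fun j => avg μ φ f (s (ns j)) z) Filter.atTop (nhds (f z)) := by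
  have h1 : Filter.Tendsto (fun j => eLpNorm (avg μ φ f (s j) - f) 1 (μ.restrict P))
      Filter.atTop (nhds 0) := by
    rw [ENNReal.tendsto_nhds_zero]
    intro ε hε
    obtain ⟨ρ₀, hρ₀, H⟩ := exists_eLpNorm_avg_sub_le hμ hφ hR hR0 hP hone hf hfi hε.ne'
    filter_upwards [hs.eventually (gt_mem_nhds hρ₀)] with j hj
    exact H _ (hs0 j) hj.le (hsh j)
  obtain ⟨ns, -, hns⟩ := (tendstoInMeasure_of_tendsto_eLpNorm one_ne_zero
    (fun j => (stronglyMeasurable_avg (μ := μ) hφ.1.continuous hf (s j)).aestronglyMeasurable)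
    hf.aestronglyMeasurable h1).exists_seq_tendsto_ae
  exact ⟨ns, hns⟩

end Averages

/-! ### Summation over dyadic scales -/

section Telescoping

variable {n : ℕ} {μ : Measure (E n × ℝ)} {U P : Set (E n × ℝ)} {φ f : E n × ℝ → ℝ}
  {G : E n × ℝ → ℝ≥0∞} {R h C : ℝ} {p r : ℝ≥0∞}

/-- The derivative in `ρ` of the averages of `f` at points of `P` is controlled by local integrals
of `G`. -/
def IsControlled (μ : Measure (E n × ℝ)) (φ : E n × ℝ → ℝ) (P : Set (E n × ℝ)) (R h C : ℝ)
    (f : E n × ℝ → ℝ) (G : E n × ℝ → ℝ≥0∞) : Prop :=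
  ∀ z ∈ P, ∀ ρ : ℝ, 0 < ρ → ρ ≤ h → ‖∫ w, f w * kern (divKern φ) z ρ w ∂μ‖ₑ ≤
    ENNReal.ofReal (C * (ρ * ρ⁻¹ ^ (n + 2))) * ∫⁻ w in {w | (z, w) ∈ boxRel n R ρ}, G w ∂μ

/-- Mean value inequality on `[a, 2a]`: all boxes there lie in the one of size `2a`, and the inverse
powers of the scale are largest at `a`. -/
theorem IsControlled.enorm_avg_sub_avg_le (hc : IsControlled μ φ P R h C f G)
    (hφ : IsTestIn U φ) (hR0 : 0 < R) (hC : 0 ≤ C) (hf : Integrable f μ) (hG : ∫⁻ w, G w ∂μ ≠ ⊤)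
    {z : E n × ℝ} (hz : z ∈ P) {a : ℝ} (ha : 0 < a) (hah : 2 * a ≤ h) :
    ‖avg μ φ f a z - avg μ φ f (2 * a) z‖ₑ ≤ ENNReal.ofReal (C * (a * a⁻¹ ^ (n + 2))) *
      ∫⁻ w in {w | (z, w) ∈ boxRel n R (2 * a)}, G w ∂μ := by
  set I := ∫⁻ w in {w | (z, w) ∈ boxRel n R (2 * a)}, G w ∂μ with hI
  have hIt : I ≠ ⊤ := ((setLIntegral_le_lintegral _ _).trans_lt hG.lt_top).ne
  have hmv := norm_image_sub_le_of_norm_deriv_le_segment' (f := fun ρ => avg μ φ f ρ z)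
    (f' := fun ρ => -(ρ⁻¹ * ∫ w, f w * kern (divKern φ) z ρ w ∂μ))
    (a := a) (b := 2 * a) (C := C * a⁻¹ ^ (n + 2) * I.toReal)
    (fun ρ hρ => (hasDerivAt_integral_mul_kern hf hφ z (ha.trans_le hρ.1)).hasDerivWithinAt)
    (fun ρ hρ => by
      have hρ0 : 0 < ρ := ha.trans_le hρ.1
      have h1 := hc z hz ρ hρ0 (hρ.2.le.trans hah)
      have h2 : ∫⁻ w in {w | (z, w) ∈ boxRel n R ρ}, G w ∂μ ≤ I :=
        lintegral_mono_set fun w hw => boxRel_mono hR0.le hρ0.le hρ.2.le hw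
      have h3 := h1.trans (mul_le_mul_right h2 _)
      rw [← ENNReal.ofReal_toReal hIt, ← ENNReal.ofReal_mul (by positivity),
        Real.enorm_eq_ofReal_abs, ENNReal.ofReal_le_ofReal_iff (by positivity)] at h3
      rw [norm_neg, norm_mul, norm_inv, Real.norm_eq_abs, Real.norm_eq_abs, abs_of_pos hρ0,
        inv_mul_le_iff₀ hρ0]
      refine h3.trans ?_
      have h4 : ρ⁻¹ ≤ a⁻¹ := inv_anti₀ ha hρ.1
      calc C * (ρ * ρ⁻¹ ^ (n + 2)) * I.toReal = ρ * (C * ρ⁻¹ ^ (n + 2) * I.toReal) := by ring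
        _ ≤ _ := by gcongr) (2 * a) ⟨by linarith, le_rfl⟩
  rw [← enorm_neg, neg_sub, Real.enorm_eq_ofReal_abs, ← ENNReal.ofReal_toReal hIt,
    ← ENNReal.ofReal_mul (by positivity)]
  refine ENNReal.ofReal_le_ofReal (hmv.trans_eq ?_)
  ring

variable [IsFiniteMeasure μ]

theorem exists_eLpNorm_avg_sub_avg_le (hμ : μ ≤ volume) (hφ : IsTestIn U φ) (hR0 : 0 < R)
    (hC : 0 ≤ C) (hP : MeasurableSet P) (hp : 1 ≤ p) (hpt : p ≠ ⊤) (hpr : p ≤ r) :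
    ∃ C' : ℝ, 0 ≤ C' ∧ ∀ (f : E n × ℝ → ℝ) (G : E n × ℝ → ℝ≥0∞), Integrable f μ →
      Measurable G → ∫⁻ w, G w ∂μ ≠ ⊤ → IsControlled μ φ P R h C f G →
      ∀ a : ℝ, 0 < a → 2 * a ≤ h →
      eLpNorm (avg μ φ f a - avg μ φ f (2 * a)) r (μ.restrict P) ≤
        ENNReal.ofReal (C' * a ^ (1 - (n + 2) * (p.toReal⁻¹ - r.toReal⁻¹))) * eLpNorm G p μ := by
  obtain ⟨c, hc0, hc⟩ := volume_boxRel_le (n := n) hR0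
  set σ := 1 - p.toReal⁻¹ + r.toReal⁻¹ with hσ
  refine ⟨C * (c * 2 ^ (n + 2)) ^ σ, by positivity, fun f G hf hGm hG hctl a ha hah => ?_⟩
  have hS := (isClosed_boxRel (n := n) R (2 * a)).measurableSet
  have h1 : eLpNorm (avg μ φ f a - avg μ φ f (2 * a)) r (μ.restrict P) ≤
      ENNReal.ofReal (C * (a * a⁻¹ ^ (n + 2))) *
      eLpNorm (fun z => ∫⁻ w in {w | (z, w) ∈ boxRel n R (2 * a)}, G w ∂μ) r (μ.restrict P) :=
    eLpNorm_le_mul_eLpNorm_of_ae_le_mul' (c := (C * (a * a⁻¹ ^ (n + 2))).toNNReal)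
      (ae_restrict_of_forall_mem hP fun z hz => by
        rw [enorm_eq_self]
        exact hctl.enorm_avg_sub_avg_le hφ hR0 hC hf hG hz ha hah) r
  have h2 := eLpNorm_setLIntegral_section_le (μ := μ) hS (boxRel_symm R (2 * a))
    (V := ENNReal.ofReal (c * (2 * a) ^ (n + 2))) (by simp; positivity) ENNReal.ofReal_ne_top
    (fun z => (hμ _).trans (hc (2 * a) (by positivity) z)) hp hpt hpr hGm
  refine h1.trans ((mul_le_mul_right
    ((eLpNorm_mono_measure _ Measure.restrict_le_self).trans h2) _).trans_eq ?_)
  rw [← mul_assoc, ENNReal.ofReal_rpow_of_pos (by positivity),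
    ← ENNReal.ofReal_mul (by positivity)]
  congr 2
  have h3 : (c * (2 * a) ^ (n + 2)) ^ σ = (c * 2 ^ (n + 2)) ^ σ * a ^ ((n + 2) * σ) := by
    rw [mul_pow, ← mul_assoc, Real.mul_rpow (by positivity) (by positivity),
      ← Real.rpow_natCast a, ← Real.rpow_mul ha.le]
    push_cast
    ring
  have h4 : a * a⁻¹ ^ (n + 2) = a ^ (1 - (n + 2) : ℝ) := by
    rw [Real.rpow_sub ha, Real.rpow_one, inv_pow, div_eq_mul_inv]
    congr 2
    rw [← Real.rpow_natCast]
    push_cast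
    ring
  rw [h3, h4]
  -- The kernel contributes `a^{1-(n+2)}` and the box operator `a^{(n+2)σ}`; their product is `a^θ`.
  have h5 : 1 - (n + 2) * (p.toReal⁻¹ - r.toReal⁻¹) = 1 - (n + 2) + (n + 2) * σ := by
    rw [hσ]
    ring
  rw [h5, Real.rpow_add ha]
  ring

/-- Between the scales `δ 2^{-j}` the increments decay like `2^{-jθ}`, so they sum to a multiple of
`δ^θ`. Almost everywhere convergence along a subsequence and Fatou's lemma pass to the limit, also
for `r = ∞`. -/
theorem exists_eLpNorm_sub_avg_le (hμ : μ ≤ volume) (hφ : IsTestIn U φ)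
    (hR : U ⊆ Metric.closedBall 0 R) (hR0 : 0 < R) (hC : 0 ≤ C) (hP : MeasurableSet P)
    (hone : ∀ z ∈ P, ∀ ρ : ℝ, 0 < ρ → ρ ≤ h → ∫ w, kern φ z ρ w ∂μ = 1)
    (hp : 1 ≤ p) (hpt : p ≠ ⊤) (hpr : p ≤ r) {θ : ℝ}
    (hθ : θ = 1 - (n + 2) * (p.toReal⁻¹ - r.toReal⁻¹)) (hθ0 : 0 < θ) :
    ∃ C' : ℝ, 0 ≤ C' ∧ ∀ (f : E n × ℝ → ℝ) (G : E n × ℝ → ℝ≥0∞), StronglyMeasurable f →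
      Integrable f μ → Measurable G → ∫⁻ w, G w ∂μ ≠ ⊤ → IsControlled μ φ P R h C f G →
      ∀ δ : ℝ, 0 < δ → δ ≤ h →
      eLpNorm (f - avg μ φ f δ) r (μ.restrict P) ≤
        ENNReal.ofReal (C' * δ ^ θ) * eLpNorm G p μ := by
  obtain ⟨C₁, hC₁, H⟩ := exists_eLpNorm_avg_sub_avg_le (h := h) hμ hφ hR0 hC hP hp hpt hpr
  set q : ℝ := (1 / 2 : ℝ) ^ θ with hq
  have hq0 : 0 ≤ q := by positivity
  have hq1 : q < 1 := Real.rpow_lt_one (by norm_num) (by norm_num) hθ0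
  refine ⟨C₁ * (1 - q)⁻¹, mul_nonneg hC₁ (inv_nonneg.2 (sub_nonneg.2 hq1.le)),
    fun f G hf hfi hGm hG hctl δ hδ hδh => ?_⟩
  have hm : ∀ ρ, AEStronglyMeasurable (avg μ φ f ρ) (μ.restrict P) := fun ρ =>
    (stronglyMeasurable_avg (μ := μ) hφ.1.continuous hf ρ).aestronglyMeasurable
  set s : ℕ → ℝ := fun j => δ * (1 / 2) ^ j with hs
  have hs0 : ∀ j, 0 < s j := fun j => by positivity
  have hsδ : ∀ j, s j ≤ δ := fun j =>
    mul_le_of_le_one_right hδ.le (pow_le_one₀ (by norm_num) (by norm_num))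
  have hss : ∀ j, 2 * s (j + 1) = s j := fun j => by simp only [hs]; ring
  have hstep : ∀ j, eLpNorm (avg μ φ f (s (j + 1)) - avg μ φ f (s j)) r (μ.restrict P) ≤
      ENNReal.ofReal (C₁ * δ ^ θ * q ^ j) * eLpNorm G p μ := fun j => by
    have h1 := H f G hfi hGm hG hctl (s (j + 1)) (hs0 _) ((hss j).trans_le ((hsδ j).trans hδh))
    rw [hss, ← hθ] at h1
    refine h1.trans (mul_le_mul_left (ENNReal.ofReal_le_ofReal ?_) _)
    have h2 : s (j + 1) ≤ s j := by linarith [hss j, hs0 (j + 1)]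
    calc C₁ * s (j + 1) ^ θ ≤ C₁ * s j ^ θ := by
          gcongr
      _ = C₁ * δ ^ θ * q ^ j := by
          rw [hs, hq, Real.mul_rpow hδ.le (by positivity), ← Real.rpow_natCast,
            ← Real.rpow_natCast, ← Real.rpow_mul (by norm_num), ← Real.rpow_mul (by norm_num),
            mul_comm θ, mul_assoc]
  have hsum : ∀ m, eLpNorm (avg μ φ f (s m) - avg μ φ f δ) r (μ.restrict P) ≤
      ENNReal.ofReal (C₁ * δ ^ θ * ∑ j ∈ Finset.range m, q ^ j) * eLpNorm G p μ := fun m => by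
    induction m with
    | zero => simp [hs]
    | succ m ih =>
      have h1 : avg μ φ f (s (m + 1)) - avg μ φ f δ =
          (avg μ φ f (s (m + 1)) - avg μ φ f (s m)) + (avg μ φ f (s m) - avg μ φ f δ) := by abel
      rw [h1, Finset.sum_range_succ, mul_add, ENNReal.ofReal_add (by positivity) (by positivity),
        add_mul]
      exact (eLpNorm_add_le ((hm _).sub (hm _)) ((hm _).sub (hm _)) (hp.trans hpr)).trans
        ((add_le_add (hstep m) ih).trans_eq (add_comm _ _))
  have hbd : ∀ m, eLpNorm (avg μ φ f (s m) - avg μ φ f δ) r (μ.restrict P) ≤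
      ENNReal.ofReal (C₁ * (1 - q)⁻¹ * δ ^ θ) * eLpNorm G p μ := fun m => by
    refine (hsum m).trans (mul_le_mul_left (ENNReal.ofReal_le_ofReal ?_) _)
    have h1 : ∑ j ∈ Finset.range m, q ^ j ≤ (1 - q)⁻¹ := by
      rw [← tsum_geometric_of_lt_one hq0 hq1]
      exact (summable_geometric_of_lt_one hq0 hq1).sum_le_tsum _ fun j _ => by positivity
    calc C₁ * δ ^ θ * ∑ j ∈ Finset.range m, q ^ j ≤ C₁ * δ ^ θ * (1 - q)⁻¹ := by gcongr
      _ = _ := by ring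
  have hslim : Filter.Tendsto s Filter.atTop (nhds 0) := by
    have h1 := (tendsto_pow_atTop_nhds_zero_of_lt_one (r := (1 / 2 : ℝ)) (by norm_num)
      (by norm_num)).const_mul δ
    rwa [mul_zero] at h1
  obtain ⟨ns, hns⟩ := exists_subseq_avg_tendsto hμ hφ hR hR0 hP hone hf hfi hs0
    (fun j => (hsδ j).trans hδh) hslim
  refine (Lp.eLpNorm_lim_le_liminf_eLpNorm (p := r)
    (f := fun j => avg μ φ f (s (ns j)) - avg μ φ f δ)
    (fun j => (hm _).sub (hm _)) (f - avg μ φ f δ) ?_).trans ?_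
  · filter_upwards [hns] with z hz
    exact hz.sub_const _
  · exact Filter.liminf_le_of_frequently_le' (Filter.Frequently.of_forall fun j => hbd (ns j))

end Telescoping

/-! ### Calculus of estimates modulo functionals -/

section SmallModuloFunctionals

variable {X : Type*} [NormedAddCommGroup X] [NormedSpace ℝ X] {q q' : X → ℝ≥0∞}

/-- Up to an arbitrarily small multiple of the norm, `q` is bounded by finitely many
functionals. -/
def SmallModuloFunctionals (q : X → ℝ≥0∞) : Prop :=
  ∀ ε : ℝ, 0 < ε → ∃ L : List (X →L[ℝ] ℝ), ∀ u,
    q u ≤ ENNReal.ofReal (ε * ‖u‖ + (L.map fun l => |l u|).sum)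

theorem sum_abs_functionals_nonneg (L : List (X →L[ℝ] ℝ)) (u : X) :
    0 ≤ (L.map fun l => |l u|).sum :=
  List.sum_nonneg fun x hx => by
    obtain ⟨l, -, rfl⟩ := List.mem_map.1 hx
    exact abs_nonneg _

namespace SmallModuloFunctionals

theorem zero : SmallModuloFunctionals (fun _ : X => (0 : ℝ≥0∞)) := fun _ _ => ⟨[], by simp⟩

theorem mono (h : SmallModuloFunctionals q') (hq : ∀ u, q u ≤ q' u) :
    SmallModuloFunctionals q := fun ε hε =>
  (h ε hε).imp fun _ hL u => (hq u).trans (hL u)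

theorem add (h : SmallModuloFunctionals q) (h' : SmallModuloFunctionals q') :
    SmallModuloFunctionals fun u => q u + q' u := fun ε hε => by
  obtain ⟨L, hL⟩ := h (ε / 2) (half_pos hε)
  obtain ⟨L', hL'⟩ := h' (ε / 2) (half_pos hε)
  refine ⟨L ++ L', fun u => (add_le_add (hL u) (hL' u)).trans_eq ?_⟩
  have := sum_abs_functionals_nonneg L u
  have := sum_abs_functionals_nonneg L' u
  rw [← ENNReal.ofReal_add (by positivity) (by positivity), List.map_append, List.sum_append]
  congr 1
  ring

theorem sum {ι : Type*} (s : Finset ι) {Q : ι → X → ℝ≥0∞}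
    (h : ∀ i ∈ s, SmallModuloFunctionals (Q i)) :
    SmallModuloFunctionals fun u => ∑ i ∈ s, Q i u := by
  classical
  induction s using Finset.induction_on with
  | empty => simpa using zero
  | insert a s ha ih =>
    simp only [Finset.sum_insert ha]
    exact (h a (Finset.mem_insert_self a s)).add
      (ih fun i hi => h i (Finset.mem_insert_of_mem hi))

/-- The case `ε = 1` already contains boundedness, hence membership in `L^r` and continuity of the
embedding. -/
theorem exists_le_mul_norm (h : SmallModuloFunctionals q) :
    ∃ C : ℝ, 0 ≤ C ∧ ∀ u, q u ≤ ENNReal.ofReal (C * ‖u‖) := by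
  obtain ⟨L, hL⟩ := h 1 one_pos
  refine ⟨1 + (L.map fun l => ‖l‖).sum, ?_, fun u => (hL u).trans (ENNReal.ofReal_le_ofReal ?_)⟩
  · refine add_nonneg zero_le_one (List.sum_nonneg fun x hx => ?_)
    obtain ⟨l, -, rfl⟩ := List.mem_map.1 hx
    exact norm_nonneg _
  · rw [add_mul, ← List.sum_map_mul_right]
    gcongr
    exact List.sum_le_sum fun l _ => l.le_opNorm u

end SmallModuloFunctionals

end SmallModuloFunctionals

/-! ### Functionals given by smooth kernels -/

section LpFunctionals

variable {n : ℕ} {Ω : Opens (E n)} {T : ℝ} {p : ℝ≥0∞} [Fact (1 ≤ p)]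
  [IsFiniteMeasure (cylMeasure Ω T)]

theorem exists_integral_abs_le (Ω : Opens (E n)) (T : ℝ) (p : ℝ≥0∞) [Fact (1 ≤ p)]
    [IsFiniteMeasure (cylMeasure Ω T)] :
    ∃ K : ℝ, 0 ≤ K ∧ ∀ f : Lp ℝ p (cylMeasure Ω T),
      ∫ w, |f w| ∂(cylMeasure Ω T) ≤ K * ‖f‖ := by
  have hp : 1 ≤ p := Fact.out
  have he : 0 ≤ 1 / (1 : ℝ≥0∞).toReal - 1 / p.toReal := by
    rcases eq_or_ne p ⊤ with rfl | hpt
    · simp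
    · have h1 : 1 ≤ p.toReal := by simpa using ENNReal.toReal_mono hpt hp
      simpa using inv_le_one_of_one_le₀ h1
  set A := cylMeasure Ω T Set.univ ^ (1 / (1 : ℝ≥0∞).toReal - 1 / p.toReal) with hA
  have hAt : A ≠ ⊤ := ENNReal.rpow_ne_top_of_nonneg he (measure_ne_top _ _)
  refine ⟨A.toReal, ENNReal.toReal_nonneg, fun f => ?_⟩
  have h1 := eLpNorm_le_eLpNorm_mul_rpow_measure_univ hp (Lp.aestronglyMeasurable f)
  have h2 : ∫ w, |f w| ∂(cylMeasure Ω T) = (eLpNorm f 1 (cylMeasure Ω T)).toReal := by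
    rw [eLpNorm_one_eq_lintegral_enorm]
    exact integral_norm_eq_lintegral_enorm (Lp.aestronglyMeasurable f)
  rw [h2, Lp.norm_def, mul_comm, ← ENNReal.toReal_mul]
  exact ENNReal.toReal_mono (ENNReal.mul_ne_top (Lp.eLpNorm_ne_top f) hAt) h1

theorem exists_functional_integral_mul {ψ : E n × ℝ → ℝ} (hψ : ContDiff ℝ ∞ ψ)
    (hc : HasCompactSupport ψ) :
    ∃ l : Lp ℝ p (cylMeasure Ω T) →L[ℝ] ℝ, ∀ f, l f = ∫ w, f w * ψ w ∂(cylMeasure Ω T) := by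
  obtain ⟨K, -, hK⟩ := exists_integral_abs_le Ω T p
  obtain ⟨B, hB⟩ := hψ.continuous.bounded_above_of_compact_support hc
  have hB0 : 0 ≤ B := (norm_nonneg _).trans (hB 0)
  let l : Lp ℝ p (cylMeasure Ω T) →ₗ[ℝ] ℝ :=
    { toFun := fun f => ∫ w, f w * ψ w ∂(cylMeasure Ω T)
      map_add' := fun f g => by
        rw [← integral_add (integrable_mul f hψ hc) (integrable_mul g hψ hc)]
        refine integral_congr_ae ?_
        filter_upwards [Lp.coeFn_add f g] with w hw
        rw [hw, Pi.add_apply, add_mul]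
      map_smul' := fun c f => by
        rw [RingHom.id_apply, smul_eq_mul, ← integral_const_mul]
        refine integral_congr_ae ?_
        filter_upwards [Lp.coeFn_smul c f] with w hw
        rw [hw, Pi.smul_apply, smul_eq_mul, mul_assoc] }
  refine ⟨l.mkContinuous (B * K) fun f => ?_, fun f => rfl⟩
  change ‖∫ w, f w * ψ w ∂(cylMeasure Ω T)‖ ≤ _
  calc ‖∫ w, f w * ψ w ∂(cylMeasure Ω T)‖ ≤ ∫ w, B * |f w| ∂(cylMeasure Ω T) := by
        refine norm_integral_le_of_norm_le ((integrable_Lp f).abs.const_mul B)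
          (Filter.Eventually.of_forall fun w => ?_)
        rw [norm_mul, mul_comm, Real.norm_eq_abs (f w)]
        gcongr
        exact hB w
    _ ≤ B * K * ‖f‖ := by
        rw [integral_const_mul, mul_assoc]
        gcongr
        exact hK f

end LpFunctionals

/-! ### The estimate on one patch -/

section PatchEstimate

variable {n : ℕ} {Ω : Opens (E n)} {T : ℝ} {p r : ℝ≥0∞} [Fact (1 ≤ p)]

/-- The derivatives in `ρ` of the averages of `D u` against kernels supported in `U` are controlled
by local integrals of the derivatives of `u`. -/
def HasAverageBounds (Ω : Opens (E n)) (T : ℝ) (p : ℝ≥0∞) [Fact (1 ≤ p)]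
    (D : W21 Ω T p →L[ℝ] Lp ℝ p (cylMeasure Ω T)) : Prop :=
  ∀ (U : Set (E n × ℝ)) (φ : E n × ℝ → ℝ) (R : ℝ), IsTestIn U φ → U ⊆ Metric.closedBall 0 R →
    ∃ C : ℝ, 0 ≤ C ∧ ∀ (u : W21 Ω T p) (z : E n × ℝ) (ρ : ℝ), 0 < ρ → ρ ≤ 1 →
      (∀ y ∈ U, z + dil ρ y ∈ (Ω : Set (E n)) ×ˢ Set.Ioo 0 T) →
      ‖∫ w, D u w * kern (divKern φ) z ρ w ∂(cylMeasure Ω T)‖ₑ ≤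
        ENNReal.ofReal (C * (ρ * ρ⁻¹ ^ (n + 2))) *
          ∫⁻ w in {w | (z, w) ∈ boxRel n R ρ}, derivSum u w ∂(cylMeasure Ω T)

theorem exists_normalized_isTestIn {U : Set (E n × ℝ)} {w₀ : E n × ℝ} (hU : U ∈ nhds w₀) :
    ∃ φ : E n × ℝ → ℝ, IsTestIn U φ ∧ ∫ y, φ y = 1 := by
  obtain ⟨φ, hs, hc, hφ, hrange, h1⟩ := exists_contDiff_tsupport_subset (n := ⊤) hU
  have hpos : 0 < ∫ y, φ y :=
    hφ.continuous.integral_pos_of_hasCompactSupport_nonneg_nonzero hc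
      (fun y => (hrange ⟨y, rfl⟩).1) (x := w₀) (by simp [h1])
  refine ⟨fun y => (∫ y, φ y)⁻¹ * φ y, IsTestIn.mul_left ⟨hφ, hc, hs⟩ contDiff_const, ?_⟩
  rw [integral_const_mul, inv_mul_cancel₀ hpos.ne']

/-- The patch condition keeps the support of the kernel inside the cylinder, so restricting the
measure loses no mass. -/
theorem integral_kern_cylMeasure {U P : Set (E n × ℝ)} {φ : E n × ℝ → ℝ} {h : ℝ}
    (hφ : IsTestIn U φ) (hone : ∫ y, φ y = 1) (hP : IsPatch Ω T P U h) {z : E n × ℝ} (hz : z ∈ P)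
    {ρ : ℝ} (hρ : 0 < ρ) (hρh : ρ ≤ h) : ∫ w, kern φ z ρ w ∂(cylMeasure Ω T) = 1 := by
  rw [← hone, ← integral_kern hφ z hρ]
  refine setIntegral_eq_integral_of_forall_compl_eq_zero fun w hw => ?_
  refine image_eq_zero_of_notMem_tsupport fun hw' => hw ?_
  have h1 := (hφ.isTest_kern hρ.ne' (hP z hz ρ hρ hρh)).2.2 hw'
  exact ⟨h1.1, Set.Ioo_subset_Ioc_self h1.2⟩

variable [IsFiniteMeasure (cylMeasure Ω T)]

/-- The averages at a fixed scale are controlled by finitely many of them. -/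
theorem smallModuloFunctionals_avg (D : W21 Ω T p →L[ℝ] Lp ℝ p (cylMeasure Ω T))
    {U P : Set (E n × ℝ)} {φ : E n × ℝ → ℝ} {δ : ℝ} (hφ : IsTestIn U φ)
    (hPm : MeasurableSet P) (hPb : Bornology.IsBounded P)
    (hδ : 0 < δ) (hP : IsPatch Ω T P U δ) (r : ℝ≥0∞) :
    SmallModuloFunctionals fun u =>
      eLpNorm (avg (cylMeasure Ω T) φ (D u) δ) r ((cylMeasure Ω T).restrict P) := by
  intro ε hε
  obtain ⟨K, hK0, hK⟩ := exists_integral_abs_le Ω T p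
  -- `M` converts pointwise bounds on `P` into `L^r` bounds; for `r = ⊤` the exponent is `0` and `M
  -- = 1`.
  set M := (cylMeasure Ω T P ^ r.toReal⁻¹).toReal with hM
  have hMt : cylMeasure Ω T P ^ r.toReal⁻¹ ≠ ⊤ :=
    ENNReal.rpow_ne_top_of_nonneg (by positivity) (measure_ne_top _ _)
  have hM0 : 0 ≤ M := ENNReal.toReal_nonneg
  obtain ⟨κ, hκ0, hκ⟩ : ∃ κ : ℝ, 0 < κ ∧ M * (κ * (K * ‖D‖)) ≤ ε := by
    refine ⟨ε / (M * (K * ‖D‖) + 1), by positivity, ?_⟩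
    have hA : 0 ≤ M * (K * ‖D‖) := by positivity
    calc M * (ε / (M * (K * ‖D‖) + 1) * (K * ‖D‖))
        = ε * ((M * (K * ‖D‖)) / (M * (K * ‖D‖) + 1)) := by ring
      _ ≤ ε * 1 := by
          gcongr
          exact div_le_one_of_le₀ (by linarith) (by positivity)
      _ = ε := mul_one ε
  -- The factor `δ ^ (n + 2)` cancels the prefactor of the kernel, and `Λ + 1` below accounts for
  -- the stretching by `dil δ⁻¹`.
  obtain ⟨τ, hτ0, hτ⟩ := Metric.uniformContinuous_iff.1
    (hφ.2.1.uniformContinuous_of_continuous hφ.1.continuous) (δ ^ (n + 2) * κ) (by positivity)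
  set Λ := ‖(dil δ⁻¹ : E n × ℝ →L[ℝ] E n × ℝ)‖ with hΛ
  have hker : ∀ z z' : E n × ℝ, dist z z' < τ / (Λ + 1) → ∀ w,
      |kern φ z δ w - kern φ z' δ w| ≤ κ := by
    intro z z' hzz w
    have h1 : dist (dil δ⁻¹ (w - z)) (dil δ⁻¹ (w - z')) < τ := by
      rw [dist_eq_norm, ← map_sub, sub_sub_sub_cancel_left]
      refine ((dil δ⁻¹).le_opNorm _).trans_lt ?_
      rw [lt_div_iff₀ (by positivity), dist_comm, dist_eq_norm] at hzz
      nlinarith [norm_nonneg (z' - z)]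
    have h2 := hτ h1
    rw [Real.dist_eq] at h2
    rw [kern, kern, ← mul_sub, abs_mul, abs_of_pos (by positivity), inv_pow,
      inv_mul_le_iff₀ (by positivity)]
    exact h2.le
  obtain ⟨t, htP, htf, ht⟩ := Metric.finite_approx_of_totallyBounded
    (hPb.isCompact_closure.totallyBounded.subset subset_closure) (τ / (Λ + 1)) (by positivity)
  have hl : ∀ z ∈ P, ∃ l : Lp ℝ p (cylMeasure Ω T) →L[ℝ] ℝ, ∀ f, l f = ∫ w, f w * kern φ z δ w ∂(cylMeasure Ω T) := fun z hz =>
    have hk := hφ.isTest_kern hδ.ne' (hP z hz δ hδ le_rfl)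
    exists_functional_integral_mul hk.1 hk.2.1
  choose! l hl using hl
  refine ⟨htf.toFinset.toList.map fun z => M • (l z).comp D, fun u => ?_⟩
  have hsum : ((htf.toFinset.toList.map fun z => M • (l z).comp D).map fun l => |l u|).sum =
      M * ∑ z ∈ htf.toFinset, |l z (D u)| := by
    rw [List.map_map, Finset.sum_map_toList, Finset.mul_sum]
    refine Finset.sum_congr rfl fun z _ => ?_
    simp [abs_mul, abs_of_nonneg hM0]
  rw [hsum]
  -- Replacing `z` by a nearby net point changes the kernel by at most `κ`, hence the average by at
  -- most `κ ∫ |D u|`.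
  have hpt : ∀ z ∈ P, ‖avg (cylMeasure Ω T) φ (D u) δ z‖ ≤
      κ * (K * ‖D‖) * ‖u‖ + ∑ z ∈ htf.toFinset, |l z (D u)| := fun z hz => by
    obtain ⟨z', hz', hzz⟩ := Set.mem_iUnion₂.1 (ht hz)
    have hi := integrable_Lp (D u)
    have h1 : avg (cylMeasure Ω T) φ (D u) δ z = (∫ w, D u w * (kern φ z δ w - kern φ z' δ w) ∂(cylMeasure Ω T)) +
        l z' (D u) := by
      simp only [mul_sub]
      rw [integral_sub (integrable_mul_kern hi hφ z δ) (integrable_mul_kern hi hφ z' δ),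
        hl z' (htP hz')]
      simp [avg]
    have h2 : ‖∫ w, D u w * (kern φ z δ w - kern φ z' δ w) ∂(cylMeasure Ω T)‖ ≤ κ * (K * ‖D‖) * ‖u‖ := by
      calc _ ≤ ∫ w, κ * |D u w| ∂(cylMeasure Ω T) := by
            refine norm_integral_le_of_norm_le (hi.abs.const_mul κ)
              (Filter.Eventually.of_forall fun w => ?_)
            rw [norm_mul, mul_comm, Real.norm_eq_abs, Real.norm_eq_abs]
            gcongr
            exact hker z z' hzz w
        _ ≤ κ * (K * (‖D‖ * ‖u‖)) := by
            rw [integral_const_mul]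
            gcongr
            exact (hK _).trans (by gcongr; exact D.le_opNorm u)
        _ = _ := by ring
    rw [h1]
    refine (norm_add_le _ _).trans (add_le_add h2 ?_)
    rw [Real.norm_eq_abs]
    exact Finset.single_le_sum (f := fun z => |l z (D u)|) (fun _ _ => abs_nonneg _)
      (htf.mem_toFinset.2 hz')
  refine (eLpNorm_le_of_ae_bound (ae_restrict_of_forall_mem hPm hpt)).trans ?_
  rw [Measure.restrict_apply_univ, ← ENNReal.ofReal_toReal hMt, ← ENNReal.ofReal_mul hM0]
  refine ENNReal.ofReal_le_ofReal ?_
  rw [mul_add]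
  refine add_le_add ?_ le_rfl
  calc M * (κ * (K * ‖D‖) * ‖u‖) = M * (κ * (K * ‖D‖)) * ‖u‖ := by ring
    _ ≤ ε * ‖u‖ := by gcongr

theorem lintegral_derivSum_ne_top (u : W21 Ω T p) : ∫⁻ w, derivSum u w ∂(cylMeasure Ω T) ≠ ⊤ := by
  simp only [derivSum]
  rw [lintegral_finsetSum _ fun i _ => (Lp.stronglyMeasurable (u.wderiv i)).measurable.enorm]
  exact ENNReal.sum_ne_top.2 fun i _ => (integrable_Lp (u.wderiv i)).2.ne

theorem HasAverageBounds.smallModuloFunctionals_patch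
    {D : W21 Ω T p →L[ℝ] Lp ℝ p (cylMeasure Ω T)} (hD : HasAverageBounds Ω T p D)
    {P : Set (E n × ℝ)} {w₀ : E n × ℝ} {ε₀ h : ℝ} (hε₀ : 0 < ε₀) (hh : 0 < h) (hh1 : h ≤ 1)
    (hPm : MeasurableSet P) (hPb : Bornology.IsBounded P)
    (hP : IsPatch Ω T P (Metric.ball w₀ ε₀) h) (hpt : p ≠ ⊤) (hpr : p ≤ r)
    (hθ : 0 < 1 - (n + 2) * (p.toReal⁻¹ - r.toReal⁻¹)) :
    SmallModuloFunctionals fun u => eLpNorm (D u) r ((cylMeasure Ω T).restrict P) := by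
  have hp : 1 ≤ p := Fact.out
  set θ := 1 - (n + 2) * (p.toReal⁻¹ - r.toReal⁻¹) with hθdef
  obtain ⟨φ, hφ, hone⟩ := exists_normalized_isTestIn (Metric.ball_mem_nhds w₀ hε₀)
  have hR0 : 0 < ‖w₀‖ + ε₀ := by positivity
  have hR : Metric.ball w₀ ε₀ ⊆ Metric.closedBall 0 (‖w₀‖ + ε₀) := fun y hy => by
    rw [mem_closedBall_zero_iff]
    have h1 := norm_add_le w₀ (y - w₀)
    rw [add_sub_cancel] at h1
    rw [Metric.mem_ball, dist_eq_norm] at hy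
    linarith
  obtain ⟨C, hC0, hC⟩ := hD _ φ _ hφ hR
  obtain ⟨C', hC'0, H⟩ := exists_eLpNorm_sub_avg_le (μ := cylMeasure Ω T) (h := h)
    Measure.restrict_le_self hφ hR hR0 hC0 hPm (fun z hz ρ hρ hρh => integral_kern_cylMeasure hφ hone hP hz hρ hρh) hp hpt hpr
    hθdef hθ
  intro ε hε
  -- The scale is fixed first, to make the distance from `D u` to its average small; only then are
  -- the functionals for that scale chosen.
  obtain ⟨δ, hδ0, hδh, hδ⟩ : ∃ δ : ℝ, 0 < δ ∧ δ ≤ h ∧ C' * δ ^ θ ≤ ε / 2 := by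
    refine ⟨min h ((ε / 2 / (C' + 1)) ^ θ⁻¹), lt_min hh (by positivity), min_le_left _ _, ?_⟩
    have h1 : min h ((ε / 2 / (C' + 1)) ^ θ⁻¹) ^ θ ≤ ε / 2 / (C' + 1) := by
      refine (Real.rpow_le_rpow (le_min hh.le (by positivity)) (min_le_right _ _) hθ.le).trans ?_
      rw [← Real.rpow_mul (by positivity), inv_mul_cancel₀ hθ.ne', Real.rpow_one]
    calc _ ≤ C' * (ε / 2 / (C' + 1)) := by gcongr
      _ = ε / 2 * (C' / (C' + 1)) := by ring
      _ ≤ ε / 2 * 1 := by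
          gcongr
          exact div_le_one_of_le₀ (by linarith) (by positivity)
      _ = ε / 2 := mul_one _
  obtain ⟨L, hL⟩ := smallModuloFunctionals_avg D hφ hPm hPb hδ0
    (fun z hz ρ hρ hρδ => hP z hz ρ hρ (hρδ.trans hδh)) r (ε / 2) (half_pos hε)
  refine ⟨L, fun u => ?_⟩
  have hDu := Lp.stronglyMeasurable (D u)
  have h1 := H (D u) (derivSum u) hDu (integrable_Lp (D u)) (measurable_derivSum u)
    (lintegral_derivSum_ne_top u)
    (fun z hz ρ hρ hρh => hC u z ρ hρ (hρh.trans hh1) (hP z hz ρ hρ hρh)) δ hδ0 hδh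
  have h2 : ((D u : E n × ℝ → ℝ)) = (D u - avg (cylMeasure Ω T) φ (D u) δ) + avg (cylMeasure Ω T) φ (D u) δ := by abel
  have hm := stronglyMeasurable_avg (μ := cylMeasure Ω T) hφ.1.continuous hDu δ
  have h3 := eLpNorm_add_le (μ := (cylMeasure Ω T).restrict P) (hDu.sub hm).aestronglyMeasurable
    hm.aestronglyMeasurable (hp.trans hpr)
  rw [← h2] at h3
  refine h3.trans ?_
  have h4 : eLpNorm (⇑(D u) - avg (cylMeasure Ω T) φ (D u) δ) r ((cylMeasure Ω T).restrict P) ≤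
      ENNReal.ofReal (ε / 2 * ‖u‖) := by
    refine h1.trans ?_
    rw [ENNReal.ofReal_mul (p := ε / 2) (by positivity)]
    exact mul_le_mul' (ENNReal.ofReal_le_ofReal hδ) (eLpNorm_derivSum_le u)
  refine (add_le_add h4 (hL u)).trans_eq ?_
  have := sum_abs_functionals_nonneg L u
  rw [← ENNReal.ofReal_add (by positivity) (by positivity)]
  congr 1
  ring

end PatchEstimate

/-! ### Completeness of the Sobolev spaces -/

section SobolevSpace

variable {n : ℕ} {Ω : Opens (E n)} {T : ℝ} {p : ℝ≥0∞} [Fact (1 ≤ p)]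
  {ι : Type} {D : ι → List (E n × ℝ)} [Fintype ι]

/-- The jet map as a linear isometry. -/
noncomputable def Sobolev.jetIsometry :
    Sobolev Ω T p D →ₗᵢ[ℝ] PiLp 1 (fun _ : Option ι => Lp ℝ p (cylMeasure Ω T)) :=
  ⟨Sobolev.jet, fun _ => rfl⟩

/-- A component of the jet as a continuous linear map. -/
noncomputable def Sobolev.jetComponent (o : Option ι) :
    Sobolev Ω T p D →L[ℝ] Lp ℝ p (cylMeasure Ω T) :=
  (PiLp.proj 1 (fun _ : Option ι => Lp ℝ p (cylMeasure Ω T)) o).comp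
    Sobolev.jetIsometry.toContinuousLinearMap

theorem Sobolev.range_jetIsometry :
    Set.range (Sobolev.jetIsometry : Sobolev Ω T p D →ₗᵢ[ℝ] _) =
      {F | ∀ i, HasWeakDeriv Ω T (D i) (F.ofLp none) (F.ofLp (some i))} := by
  ext F
  constructor
  · rintro ⟨u, rfl⟩ i
    exact u.hasWeakDeriv i
  · intro hF
    let u : Sobolev Ω T p D := ⟨F.ofLp none, fun i => ⟨_, hF i⟩⟩
    refine ⟨u, ?_⟩
    ext1 o
    cases o with
    | none => rfl
    | some i => exact (u.hasWeakDeriv i).unique (hF i)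

/-- The jets are cut out of a complete space by the defining identities of weak derivatives, each an
equality of continuous functionals. Completeness of the target is needed in the compactness
criterion. -/
instance Sobolev.completeSpace [IsFiniteMeasure (cylMeasure Ω T)] :
    CompleteSpace (Sobolev Ω T p D) := by
  have hcl : IsClosed (Set.range (Sobolev.jetIsometry : Sobolev Ω T p D →ₗᵢ[ℝ] _)) := by
    rw [Sobolev.range_jetIsometry]
    simp only [HasWeakDeriv, Set.ofPred_forall]
    refine isClosed_iInter fun i => isClosed_iInter fun φ => isClosed_iInter fun hφ => ?_
    obtain ⟨l, hl⟩ := exists_functional_integral_mul (Ω := Ω) (T := T) (p := p)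
      (contDiff_iterDeriv (D i) hφ.1) (hasCompactSupport_iterDeriv (D i) hφ.2.1)
    obtain ⟨l', hl'⟩ := exists_functional_integral_mul (Ω := Ω) (T := T) (p := p) hφ.1 hφ.2.1
    simp only [← hl, ← hl']
    exact isClosed_eq
      (l.continuous.comp (PiLp.continuous_apply 1
        (fun _ : Option ι => Lp ℝ p (cylMeasure Ω T)) none))
      (continuous_const.mul (l'.continuous.comp (PiLp.continuous_apply 1
        (fun _ : Option ι => Lp ℝ p (cylMeasure Ω T)) (some i))))
  exact (completeSpace_iff_isComplete_range
    (Sobolev.jetIsometry (D := D)).isometry.isUniformInducing).2 hcl.isComplete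

end SobolevSpace

/-! ### From patches to the cylinder, and the embedding -/

section GlobalEstimate

variable {n : ℕ} {Ω : Opens (E n)} {T : ℝ} {p r : ℝ≥0∞} [Fact (1 ≤ p)]

theorem eLpNorm_add_measure_le {α : Type*} [MeasurableSpace α] (f : α → ℝ) (hr : 1 ≤ r)
    (μ ν : Measure α) : eLpNorm f r (μ + ν) ≤ eLpNorm f r μ + eLpNorm f r ν := by
  rcases eq_or_ne r ⊤ with rfl | hrt
  · simp only [eLpNorm_exponent_top]
    refine essSup_le_of_ae_le _ (ae_add_measure_iff.2 ⟨?_, ?_⟩)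
    · filter_upwards [enorm_ae_le_eLpNormEssSup f μ] with x hx using hx.trans le_self_add
    · filter_upwards [enorm_ae_le_eLpNormEssSup f ν] with x hx using hx.trans le_add_self
  · have hr0 : r ≠ 0 := (zero_lt_one.trans_le hr).ne'
    have hr1 : 1 ≤ r.toReal := by simpa using ENNReal.toReal_mono hrt hr
    simp only [eLpNorm_eq_lintegral_rpow_enorm_toReal hr0 hrt, lintegral_add_measure]
    refine ENNReal.rpow_add_le_add_rpow _ _ (by positivity) ?_
    rw [one_div]
    exact inv_le_one_of_one_le₀ hr1

theorem eLpNorm_restrict_union_le {α : Type*} [MeasurableSpace α] (f : α → ℝ) (hr : 1 ≤ r)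
    (μ : Measure α) (A B : Set α) :
    eLpNorm f r (μ.restrict (A ∪ B)) ≤ eLpNorm f r (μ.restrict A) + eLpNorm f r (μ.restrict B) :=
  (eLpNorm_mono_measure f (Measure.restrict_union_le A B)).trans
    (eLpNorm_add_measure_le f hr _ _)

/-- Compactness of `closure Ω` reduces the claim to finitely many patches. The `L^r` norm is
subadditive in the domain of integration, so no partition of unity is needed. -/
theorem HasAverageBounds.smallModuloFunctionals [IsFiniteMeasure (cylMeasure Ω T)]
    {D : W21 Ω T p →L[ℝ] Lp ℝ p (cylMeasure Ω T)} (hD : HasAverageBounds Ω T p D)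
    (hbdd : Bornology.IsBounded (Ω : Set (E n))) (hlip : HasLipschitzBoundary (Ω : Set (E n)))
    (hT : 0 < T) (hpt : p ≠ ⊤) (hpr : p ≤ r)
    (hθ : 0 < 1 - (n + 2) * (p.toReal⁻¹ - r.toReal⁻¹)) :
    SmallModuloFunctionals fun u => eLpNorm (D u) r (cylMeasure Ω T) := by
  have hr : 1 ≤ r := (Fact.out : 1 ≤ p).trans hpr
  have key : SmallModuloFunctionals fun u => eLpNorm (D u) r
      ((cylMeasure Ω T).restrict ((closure (Ω : Set (E n)) ∩ Ω) ×ˢ Set.Ioc 0 T)) := by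
    refine hbdd.isCompact_closure.induction_on
      (p := fun s => SmallModuloFunctionals fun u => eLpNorm (D u) r
        ((cylMeasure Ω T).restrict ((s ∩ (Ω : Set (E n))) ×ˢ Set.Ioc 0 T))) ?_ ?_ ?_ ?_
    · simpa using SmallModuloFunctionals.zero
    · intro s t hst ht
      refine ht.mono fun u => eLpNorm_mono_measure _ (Measure.restrict_mono ?_ le_rfl)
      gcongr
    · intro s t hs ht
      refine (hs.add ht).mono fun u => ?_
      rw [Set.union_inter_distrib_right, Set.union_prod]
      exact eLpNorm_restrict_union_le _ hr _ _ _
    · intro x hx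
      obtain ⟨V, hV, hxV, e, ε, h, hε, hh, hh1, h1, h2⟩ := hlip.exists_isPatch hT hx
      refine ⟨V, mem_nhdsWithin_of_mem_nhds (hV.mem_nhds hxV), ?_⟩
      have hm : ∀ a b : ℝ, MeasurableSet ((V ∩ (Ω : Set (E n))) ×ˢ Set.Ioc a b) := fun a b =>
        (hV.inter Ω.isOpen).measurableSet.prod measurableSet_Ioc
      have hb : ∀ a b : ℝ, Bornology.IsBounded ((V ∩ (Ω : Set (E n))) ×ˢ Set.Ioc a b) :=
        fun a b => (hbdd.subset Set.inter_subset_right).prod (Metric.isBounded_Ioc a b)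
      refine ((hD.smallModuloFunctionals_patch hε hh hh1 (hm _ _) (hb _ _) h1 hpt hpr hθ).add
        (hD.smallModuloFunctionals_patch hε hh hh1 (hm _ _) (hb _ _) h2 hpt hpr hθ)).mono
        fun u => ?_
      rw [← Set.Ioc_union_Ioc_eq_Ioc (half_pos hT).le (half_le_self hT.le), Set.prod_union]
      exact eLpNorm_restrict_union_le _ hr _ _ _
  refine key.mono fun u => le_of_eq ?_
  rw [Set.inter_eq_right.2 subset_closure]
  change _ = eLpNorm (D u) r ((volume.restrict (cylinder Ω T)).restrict (cylinder Ω T))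
  rw [Measure.restrict_restrict_of_subset le_rfl]
  rfl

/-- All three conditions imply `1/p - 1/r < 1/(n+2)`, with `1/r` read as `0` when `r = ⊤`, in
agreement with `ENNReal.toReal`. -/
theorem exponent_pos {n : ℕ} {p r : ℝ≥0∞} (hp : 1 ≤ p)
    (hpr : (p < n + 2 ∧ p ≤ r ∧ r < p * (n + 2) / (n + 2 - p)) ∨
      (p = n + 2 ∧ n + 2 ≤ r ∧ r < ⊤) ∨ (n + 2 < p ∧ p < ⊤ ∧ r = ⊤)) :
    p ≠ ⊤ ∧ 0 < 1 - (n + 2 : ℝ) * (p.toReal⁻¹ - r.toReal⁻¹) := by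
  have hn : ((n : ℝ≥0∞) + 2) = ENNReal.ofReal (n + 2) := by
    rw [ENNReal.ofReal_add (by positivity) (by positivity)]
    simp
  have hnt : ((n : ℝ≥0∞) + 2) ≠ ⊤ := by simp
  rcases hpr with ⟨h1, h2, h3⟩ | ⟨h1, h2, h3⟩ | ⟨h1, h2, rfl⟩
  · have hpt : p ≠ ⊤ := h1.ne_top
    have hrt : r ≠ ⊤ := h3.ne_top
    refine ⟨hpt, ?_⟩
    lift p to ℝ≥0 using hpt
    lift r to ℝ≥0 using hrt
    have hp1 : (1 : ℝ) ≤ p := by exact_mod_cast hp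
    have hpr' : (p : ℝ) ≤ r := by exact_mod_cast h2
    have hpn : (p : ℝ) < n + 2 := by exact_mod_cast h1
    rw [ENNReal.lt_div_iff_mul_lt (Or.inl (tsub_pos_of_lt h1).ne')
      (Or.inl (ENNReal.sub_ne_top hnt))] at h3
    have h4 : (r : ℝ) * (n + 2 - p) < p * (n + 2) := by
      have h5 := (ENNReal.toReal_lt_toReal (ENNReal.mul_ne_top (by simp)
        (ENNReal.sub_ne_top hnt)) (ENNReal.mul_ne_top (by simp) hnt)).2 h3
      rw [ENNReal.toReal_mul, ENNReal.toReal_mul, ENNReal.toReal_sub_of_le h1.le hnt] at h5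
      simpa [hn, ENNReal.toReal_ofReal (by positivity : (0 : ℝ) ≤ n + 2)] using h5
    simp only [ENNReal.coe_toReal]
    have hp0 : (0 : ℝ) < p := by linarith
    have hr0 : (0 : ℝ) < r := by linarith
    have h6 : 1 - (n + 2 : ℝ) * ((p : ℝ)⁻¹ - (r : ℝ)⁻¹) =
        (p * (n + 2) - r * (n + 2 - p)) / (p * r) := by
      field_simp
      ring
    rw [h6]
    exact div_pos (by linarith) (by positivity)
  · refine ⟨h1 ▸ hnt, ?_⟩
    have hr0 : 0 < r.toReal :=
      ENNReal.toReal_pos ((lt_of_lt_of_le (by positivity) h2).ne') h3.ne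
    have h5 : p.toReal = n + 2 := by
      rw [h1, hn, ENNReal.toReal_ofReal (by positivity)]
    rw [h5, mul_sub, mul_inv_cancel₀ (by positivity)]
    have : 0 < (n + 2 : ℝ) * r.toReal⁻¹ := by positivity
    linarith
  · refine ⟨h2.ne, ?_⟩
    have h5 : (n + 2 : ℝ) < p.toReal := by
      have := (ENNReal.toReal_lt_toReal hnt h2.ne).2 h1
      rwa [hn, ENNReal.toReal_ofReal (by positivity)] at this
    have hp0 : 0 < p.toReal := lt_trans (by positivity) h5
    simp only [ENNReal.toReal_top, inv_zero, sub_zero]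
    rw [← div_eq_mul_inv, sub_pos, div_lt_one hp0]
    exact h5

theorem HasWeakDeriv.congr_ae {vs : List (E n × ℝ)} {f f' g g' : E n × ℝ → ℝ}
    (h : HasWeakDeriv Ω T vs f g) (hf : f =ᵐ[cylMeasure Ω T] f')
    (hg : g =ᵐ[cylMeasure Ω T] g') : HasWeakDeriv Ω T vs f' g' := fun φ hφ => by
  have h1 : ∀ {k k' : E n × ℝ → ℝ} (ψ : E n × ℝ → ℝ), k =ᵐ[cylMeasure Ω T] k' →
      ∫ z, k z * ψ z ∂(cylMeasure Ω T) = ∫ z, k' z * ψ z ∂(cylMeasure Ω T) := fun ψ hk =>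
    integral_congr_ae (hk.mul (Filter.EventuallyEq.refl _ ψ))
  rw [← h1 _ hf, ← h1 _ hg]
  exact h φ hφ

/-- If the components of the `W^{1,0}` jet are small in `L^r` modulo functionals, then
`W^{2,1}_p` embeds compactly in `W^{1,0}_r`. -/
theorem exists_compact_embedding [Fact (1 ≤ r)] [IsFiniteMeasure (cylMeasure Ω T)]
    (h₀ : SmallModuloFunctionals fun u : W21 Ω T p => eLpNorm u.toLp r (cylMeasure Ω T))
    (h₁ : ∀ k, SmallModuloFunctionals fun u : W21 Ω T p =>
      eLpNorm (u.wderiv (Sum.inr (Sum.inl k))) r (cylMeasure Ω T)) :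
    ∃ J : W21 Ω T p →L[ℝ] W10 Ω T r,
      (∀ u : W21 Ω T p, (J u).toLp =ᵐ[cylMeasure Ω T] u.toLp) ∧
      Function.Injective J ∧ IsCompactOperator J := by
  have hm₀ : ∀ u : W21 Ω T p, MemLp u.toLp r (cylMeasure Ω T) := fun u => by
    obtain ⟨C, -, hC⟩ := h₀.exists_le_mul_norm
    exact ⟨Lp.aestronglyMeasurable _, (hC u).trans_lt ENNReal.ofReal_lt_top⟩
  have hm₁ : ∀ (u : W21 Ω T p) k,
      MemLp (u.wderiv (Sum.inr (Sum.inl k))) r (cylMeasure Ω T) := fun u k => by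
    obtain ⟨C, -, hC⟩ := (h₁ k).exists_le_mul_norm
    exact ⟨Lp.aestronglyMeasurable _, (hC u).trans_lt ENNReal.ofReal_lt_top⟩
  have hw : ∀ (u : W21 Ω T p) (k : Fin n),
      HasWeakDeriv Ω T (derivs10 n k) (hm₀ u).toLp (hm₁ u k).toLp := fun u k =>
    (u.hasWeakDeriv (Sum.inr (Sum.inl k))).congr_ae (hm₀ u).coeFn_toLp.symm
      (hm₁ u k).coeFn_toLp.symm
  let j : W21 Ω T p → W10 Ω T r := fun u => ⟨(hm₀ u).toLp, fun k => ⟨_, hw u k⟩⟩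
  have hj : ∀ u, (j u).toLp =ᵐ[cylMeasure Ω T] u.toLp := fun u => (hm₀ u).coeFn_toLp
  have hext : ∀ v v' : W10 Ω T r, v.toLp =ᵐ[cylMeasure Ω T] v'.toLp → v = v' := fun v v' h =>
    Subtype.ext (Lp.ext h)
  let J₀ : W21 Ω T p →ₗ[ℝ] W10 Ω T r :=
    { toFun := j
      map_add' := fun u v => hext _ _ <| by
        rw [map_add]
        have h1 := hj (u + v)
        rw [map_add] at h1
        filter_upwards [h1, hj u, hj v, Lp.coeFn_add u.toLp v.toLp,
          Lp.coeFn_add (j u).toLp (j v).toLp] with z a b c d e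
        rw [a, d, e, Pi.add_apply, Pi.add_apply, b, c]
      map_smul' := fun s u => hext _ _ <| by
        rw [RingHom.id_apply, map_smul]
        have h1 := hj (s • u)
        rw [map_smul] at h1
        filter_upwards [h1, hj u, Lp.coeFn_smul s u.toLp, Lp.coeFn_smul s (j u).toLp]
          with z a b c d
        rw [a, c, d, Pi.smul_apply, Pi.smul_apply, b] }
  have hsmall := h₀.add (SmallModuloFunctionals.sum Finset.univ fun k _ => h₁ k)
  have hnorm : ∀ u, ENNReal.ofReal ‖j u‖ = eLpNorm u.toLp r (cylMeasure Ω T) +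
      ∑ k, eLpNorm (u.wderiv (Sum.inr (Sum.inl k))) r (cylMeasure Ω T) := fun u => by
    -- By uniqueness, the derivatives chosen in `W^{1,0}_r` are those of `u` viewed in `L^r`, so the
    -- norm of `j u` is exactly the quantity already estimated.
    have h1 : ∀ k, (j u).wderiv k = (hm₁ u k).toLp := fun k =>
      ((j u).hasWeakDeriv k).unique (hw u k)
    have h2 : (j u).toLp = (hm₀ u).toLp := rfl
    rw [Sobolev.norm_eq, ENNReal.ofReal_add (norm_nonneg _)
      (Finset.sum_nonneg fun _ _ => norm_nonneg _),
      ENNReal.ofReal_sum_of_nonneg fun _ _ => norm_nonneg _, h2]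
    simp only [h1, Lp.norm_toLp]
    rw [ENNReal.ofReal_toReal (hm₀ u).2.ne]
    congr 1
    exact Finset.sum_congr rfl fun k _ => ENNReal.ofReal_toReal (hm₁ u k).2.ne
  obtain ⟨C, hC0, hC⟩ := hsmall.exists_le_mul_norm
  let J := J₀.mkContinuous C fun u => by
    have h1 := (hnorm u).trans_le (hC u)
    rwa [ENNReal.ofReal_le_ofReal_iff (by positivity)] at h1
  refine ⟨J, hj, fun u v huv => ?_, isCompactOperator_of_norm_le_add_functionals J fun ε hε => ?_⟩
  · refine Subtype.ext (Lp.ext (?_ : u.toLp =ᵐ[cylMeasure Ω T] v.toLp))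
    have h1 : j u = j v := huv
    exact (hj u).symm.trans (h1 ▸ hj v)
  · obtain ⟨L, hL⟩ := hsmall ε hε
    refine ⟨L, fun u => ?_⟩
    have h1 := (hnorm u).trans_le (hL u)
    have h2 := sum_abs_functionals_nonneg L u
    rwa [ENNReal.ofReal_le_ofReal_iff (by positivity)] at h1

end GlobalEstimate

end ParabolicSobolev

theorem mainTheorem11 {n : ℕ} (hn : 1 ≤ n) (Ω : TopologicalSpace.Opens (ParabolicSobolev.E n))
    (hconn : IsConnected (Ω : Set (ParabolicSobolev.E n)))
    (hbdd : Bornology.IsBounded (Ω : Set (ParabolicSobolev.E n)))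
    (hlip : ParabolicSobolev.HasLipschitzBoundary (Ω : Set (ParabolicSobolev.E n)))
    (T : ℝ) (hT : 0 < T)
    (p r : ℝ≥0∞) [Fact (1 ≤ p)] [Fact (1 ≤ r)]
    (hle : p ≤ r)
    (hpr : (p < n + 2 ∧ p ≤ r ∧ r < p * (n + 2) / (n + 2 - p)) ∨
      (p = n + 2 ∧ n + 2 ≤ r ∧ r < ⊤) ∨
      (n + 2 < p ∧ p < ⊤ ∧ r = ⊤)) :
    ∃ J : ParabolicSobolev.W21 Ω T p →L[ℝ] ParabolicSobolev.W10 Ω T r,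
      (∀ u : ParabolicSobolev.W21 Ω T p,
        (J u).toLp =ᵐ[ParabolicSobolev.cylMeasure Ω T] u.toLp) ∧
      Function.Injective J ∧ IsCompactOperator J := by
  have := ParabolicSobolev.isFiniteMeasure_cylMeasure hbdd T
  obtain ⟨hpt, hθ⟩ := ParabolicSobolev.exponent_pos Fact.out hpr
  -- The component `none` of the jet is `u` itself, and the components below are the `u_{x_k}`; no
  -- other derivative enters the target norm.
  have h₀ : ParabolicSobolev.HasAverageBounds Ω T p
      (ParabolicSobolev.Sobolev.jetComponent none) := fun _ _ _ hφ hR =>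
    ParabolicSobolev.exists_enorm_integral_toLp_mul_kern_divKern_le hφ hR
  have h₁ : ∀ k, ParabolicSobolev.HasAverageBounds Ω T p
      (ParabolicSobolev.Sobolev.jetComponent (some (Sum.inr (Sum.inl k)))) := fun k _ _ _ hφ hR =>
    ParabolicSobolev.exists_enorm_integral_wderiv_mul_kern_divKern_le hφ hR k
  exact ParabolicSobolev.exists_compact_embedding
    (h₀.smallModuloFunctionals hbdd hlip hT hpt hle hθ)
    fun k => (h₁ k).smallModuloFunctionals hbdd hlip hT hpt hle hθ
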